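/- For a finite subset $A$ of a group let $A^3=\{a_1a_2a_3 : a_1,a_2,a_3\in A\}$ and let $\langle A\rangle$ be the subgroup generated by $A$. A group is virtually cyclic (respectively virtually nilpotent) if it has a cyclic (respectively nilpotent) subgroup of finite index. An infinite group $G$ has Helfgott type growth with constants $c,\delta>0$ if every finite subset $A\subseteq G$ for which $\langle A\rangle$ is not virtually nilpotent satisfies $|A^3|\ge c\,|A|^{1+\delta}$. The group $SL(2,\mathbb Z)$ is infinite and has Helfgott type growth with $\delta=1$ and $c=1/31104$. Moreover, the only exceptions come from virtually cyclic subgroups: every finite subset $A\subseteq SL(2,\mathbb Z)$ for which $\langle A\rangle$ is not virtually cyclic satisfies $$|A^3|\ \ge\ \frac{1}{31104}\,|A|^2 .$$ -/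

import Mathlib

open scoped Pointwise MatrixGroups

/-- A group is virtually cyclic if it has a cyclic subgroup of finite index.
In particular every finite group is virtually cyclic. -/
def IsVirtuallyCyclic (G : Type*) [Group G] : Prop :=
  ∃ N : Subgroup G, IsCyclic N ∧ N.FiniteIndex

/-- Helfgott type growth of an infinite group `G` with given constants `c, δ > 0`:
every finite subset `A` of `G` generating a subgroup that is not virtually nilpotent
satisfies `|A ^ 3| ≥ c * |A| ^ (1 + δ)`, where `A ^ 3` is the set of all products
`a₁ * a₂ * a₃` of elements of `A`. -/
structure HasHelfgottTypeGrowth (G : Type*) [Group G] [DecidableEq G] (c δ : ℝ) : Prop where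
  infinite : Infinite G
  c_pos : 0 < c
  delta_pos : 0 < δ
  growth : ∀ A : Finset G,
    ¬ Group.IsVirtuallyNilpotent (Subgroup.closure (A : Set G)) →
      c * (A.card : ℝ) ^ (1 + δ) ≤ ((A ^ 3).card : ℝ)

/-! The words in two letters embed in SL(2,ℤ) as the matrices with nonnegative entries, which
reduces growth to combinatorics of words. A pigeonhole descent along the tree of SL(2,ℤ)
(`exists_near`) gives g, h such that at least |A|/18 elements of A have the form ±g w h and at least
|A|/18 the form ±h⁻¹ w g⁻¹, with w a word. Fixing signs and cutting at median lengths leaves sets P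
and X of at least |A|/72 words, one from each form, with no word of P longer than a word of X. Since
(g a h)(h⁻¹ x g⁻¹)(g b h) = g (a x b) h, the set A³ has at least |P x P| elements for each x in X.

If |P x P| ≥ |P|²/6 for some x, this suffices, as 6 · 72² = 31104. Otherwise the coincidences a x b
= a' x b' force every x in X to be periodic, with a common period and phase
(`exists_common_period`). The elements of A coming from X then lie in one coset of the centralizer
of an element of infinite order. The normalizer of that centralizer is virtually cyclic, so it
cannot contain A, and inserting a suitable t makes (x, x') ↦ x t x' at most two-to-one
(`sq_card_le_two_mul_card_pow`). -/

namespace FreeMonoid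

/-! ### Factorization and commutation of words. -/

variable {α : Type*}

/-- Levi's lemma: two factorizations of the same word are comparable. -/
theorem levi {a b c d : FreeMonoid α} (h : a * b = c * d) (hl : a.length ≤ c.length) :
    ∃ t, c = a * t ∧ b = t * d := by
  rcases List.append_eq_append_iff.1 (show toList a ++ toList b = toList c ++ toList d from h) with
    ⟨t, h1, h2⟩ | ⟨t, h1, h2⟩
  · exact ⟨t, h1, h2⟩
  · have h1' : a = c * ofList t := h1
    have h2' : d = ofList t * b := h2
    have ht : (ofList t).length = 0 := by
      have := congrArg length h1'
      rw [length_mul] at this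
      omega
    rw [length_eq_zero] at ht
    exact ⟨1, by simp [h1', ht], by simp [h2', ht]⟩

theorem levi_right {a b c d : FreeMonoid α} (h : a * b = c * d) (hl : b.length ≤ d.length) :
    ∃ t, d = t * b ∧ a = c * t := by
  have hlen := congrArg length h
  rw [length_mul, length_mul] at hlen
  obtain ⟨t, h1, h2⟩ := levi h.symm (by omega)
  exact ⟨t, h2, h1⟩

theorem mul_inj_of_length {a b c d : FreeMonoid α} (h : a * b = c * d)
    (hl : a.length = c.length) : a = c ∧ b = d := by
  obtain ⟨t, h1, h2⟩ := levi h hl.le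
  have ht : t.length = 0 := by
    have := congrArg length h1
    rw [length_mul] at this
    omega
  rw [length_eq_zero] at ht
  subst ht
  simp_all

theorem mul_inj_of_length_right {a b c d : FreeMonoid α} (h : a * b = c * d)
    (hl : b.length = d.length) : a = c ∧ b = d := by
  have hlen := congrArg length h
  rw [length_mul, length_mul] at hlen
  exact mul_inj_of_length h (by omega)

theorem length_pow (a : FreeMonoid α) (n : ℕ) : (a ^ n).length = n * a.length := by
  induction n with
  | zero => simp
  | succ n ih => rw [pow_succ, length_mul, ih]; ring

theorem length_pos {a : FreeMonoid α} (h : a ≠ 1) : 0 < a.length :=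
  Nat.pos_of_ne_zero fun h0 => h (length_eq_zero.1 h0)

theorem pow_ne_one {a : FreeMonoid α} (h : a ≠ 1) {n : ℕ} (hn : n ≠ 0) : a ^ n ≠ 1 := by
  intro h0
  have := congrArg length h0
  rw [length_pow, length_one] at this
  rcases Nat.mul_eq_zero.1 this with h1 | h1
  · exact hn h1
  · exact (length_pos h).ne' h1

theorem commute_of_eq_length {a b : FreeMonoid α} (h : Commute a b)
    (hl : a.length = b.length) : a = b :=
  (mul_inj_of_length h.eq hl).1

/-- Both v w and w v commute with a long power of u, so both are prefixes of it, of equal length. -/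
theorem commute_trans {u v w : FreeMonoid α} (hu : u ≠ 1) (hv : Commute v u)
    (hw : Commute w u) : Commute v w := by
  set n := (v * w).length with hn
  have hle : (v * w).length ≤ (u ^ n).length := by
    rw [length_pow]
    exact Nat.le_mul_of_pos_right _ (length_pos hu)
  obtain ⟨s, hs, -⟩ := levi (((hv.mul_left hw).pow_right n).eq) hle
  have hle' : (w * v).length ≤ (u ^ n).length := by
    rw [length_mul, add_comm, ← length_mul]; exact hle
  obtain ⟨t, ht, -⟩ := levi (((hw.mul_left hv).pow_right n).eq) hle'
  exact (mul_inj_of_length (hs.symm.trans ht) (by simp [length_mul, add_comm])).1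

/-- All words commuting with a nontrivial word are powers of a single word. -/
theorem exists_root {u : FreeMonoid α} (hu : u ≠ 1) :
    ∃ p : FreeMonoid α, p ≠ 1 ∧ Commute p u ∧ ∀ v, Commute v u → ∃ k : ℕ, v = p ^ k := by
  obtain ⟨p, ⟨hp1, hpu⟩, hmin⟩ : ∃ p : FreeMonoid α, (p ≠ 1 ∧ Commute p u) ∧
      ∀ v, v ≠ 1 → Commute v u → p.length ≤ v.length := by
    have hne : {v : FreeMonoid α | v ≠ 1 ∧ Commute v u}.Nonempty := ⟨u, hu, Commute.refl u⟩
    have hwf := (measure (length : FreeMonoid α → ℕ)).wf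
    exact ⟨hwf.min _ hne, hwf.min_mem _ hne,
      fun v h1 h2 => not_lt.1 (hwf.not_lt_min {v : FreeMonoid α | v ≠ 1 ∧ Commute v u} ⟨h1, h2⟩)⟩
  refine ⟨p, hp1, hpu, ?_⟩
  suffices h : ∀ n, ∀ v : FreeMonoid α, v.length = n → Commute v u → ∃ k : ℕ, v = p ^ k from
    fun v hv => h _ v rfl hv
  intro n
  induction n using Nat.strong_induction_on with
  | _ n ih =>
    intro v hvn hv
    by_cases hv1 : v = 1
    · exact ⟨0, by simp [hv1]⟩
    have hpv : Commute p v := commute_trans hu hpu hv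
    -- A shortest p is a prefix of every nontrivial v in the centralizer; stripping it leaves a
    -- shorter word of the centralizer.
    obtain ⟨t, ht, -⟩ := levi hpv.eq (hmin v hv1 hv)
    have htu : Commute t u := by
      have h1 : p * (t * u) = p * (u * t) := by
        rw [← mul_assoc, ← ht, hv.eq, ht, ← mul_assoc, ← hpu.eq, mul_assoc]
      exact mul_left_cancel h1
    have hlt : t.length < n := by
      have := length_pos hp1
      rw [← hvn, ht, length_mul]
      omega
    obtain ⟨k, hk⟩ := ih _ hlt t rfl htu
    exact ⟨k + 1, by rw [ht, hk, pow_succ']⟩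

/-! ### Periods of words. -/

/-- `u` is a period of `x`: the word `x` is a prefix of `u * x`. -/
def IsPeriod (u x : FreeMonoid α) : Prop := u ≠ 1 ∧ ∃ c, u * x = x * c

/-- A weak Fine–Wilf theorem: u v and v u are both prefixes of x, of equal length. -/
theorem IsPeriod.commute {u v x : FreeMonoid α} (hu : IsPeriod u x) (hv : IsPeriod v x)
    (hl : u.length + v.length ≤ x.length) : Commute u v := by
  obtain ⟨-, c, hc⟩ := hu
  obtain ⟨-, d, hd⟩ := hv
  obtain ⟨t, ht, -⟩ := levi hc (by omega)
  obtain ⟨s, hs, -⟩ := levi hd (by omega)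
  have h1 : (u * v) * s = x * c := by rw [mul_assoc, ← hs, hc]
  have h2 : (v * u) * t = x * d := by rw [mul_assoc, ← ht, hd]
  obtain ⟨y, hy, -⟩ := levi h1 (by rw [length_mul]; omega)
  obtain ⟨z, hz, -⟩ := levi h2 (by rw [length_mul]; omega)
  exact (mul_inj_of_length (hy.symm.trans hz) (by simp [length_mul, add_comm])).1

theorem isPeriod_of_mul_eq {u x b c : FreeMonoid α} (hu : u ≠ 1) (h : x * b = u * x * c) :
    IsPeriod u x := by
  obtain ⟨t, ht, -⟩ := levi h (by rw [length_mul]; omega)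
  exact ⟨hu, t, ht⟩

/-- Here q ends in p, and moving one p around p ^ n shows that q q ends in q p. It also ends in p q,
and the two suffixes have equal length. -/
theorem commute_of_sq_suffix_pow {p q s : FreeMonoid α} {n : ℕ} (hp : p ≠ 1)
    (hl : p.length ≤ q.length) (h : p ^ n = s * (q * q)) : Commute p q := by
  obtain rfl | ⟨m, rfl⟩ : n = 0 ∨ ∃ m, n = m + 1 := by
    cases n
    · exact Or.inl rfl
    · exact Or.inr ⟨_, rfl⟩
  · have := congrArg length h
    have := length_pos hp
    simp only [pow_zero, length_one, length_mul] at *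
    omega
  obtain ⟨q', hq', -⟩ := levi_right (show p ^ m * p = (s * q) * q by
    rw [← pow_succ, h, mul_assoc]) hl
  have h1 : (s * q) * (q * p) = (p * s) * (q * q) := by
    have := (pow_mul_comm' p (m + 1)).symm
    rw [h] at this
    simpa [mul_assoc] using this.symm
  obtain ⟨t, ht, -⟩ := levi_right h1 (by simp only [length_mul]; omega)
  have h2 : q' * (p * q) = t * (q * p) := by rw [← mul_assoc, ← hq', ht]
  exact (mul_inj_of_length_right h2 (by simp [length_mul, add_comm])).2

/-- Comparing the two endings gives q q p ^ k = t q q for some t. Iterating this makes q q a suffix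
of a high power of p, the case already treated. -/
theorem commute_of_sq_suffix {p q a c d : FreeMonoid α} {k : ℕ} (hp : p ≠ 1) (hk : k ≠ 0)
    (hl : p.length ≤ q.length) (h1 : a = c * (q * q)) (h2 : a * p ^ k = d * (q * q)) :
    Commute p q := by
  have hpk := length_pos (pow_ne_one hp hk)
  have h3 : c * ((q * q) * p ^ k) = d * (q * q) := by
    rw [← h2, h1, mul_assoc c]
  obtain ⟨t, -, ht⟩ := levi h3 (by
    have := congrArg length h3
    simp only [length_mul] at this ⊢
    omega)
  have hs : SemiconjBy (q * q) (p ^ k) t := ht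
  set m := (q * q).length with hm
  have hs' : (q * q) * (p ^ k) ^ m = t ^ m * (q * q) := hs.pow_right m
  obtain ⟨r, hr, -⟩ := levi_right hs'.symm (by
    rw [length_pow, ← hm]
    exact Nat.le_mul_of_pos_right _ hpk)
  rw [← pow_mul] at hr
  exact commute_of_sq_suffix_pow hp hl hr

theorem exists_stem {p : FreeMonoid α} (hp : p ≠ 1) (a : FreeMonoid α) :
    ∃ a₀, (∃ k : ℕ, a = a₀ * p ^ k) ∧ ∀ c, a₀ ≠ c * p := by
  suffices h : ∀ n, ∀ a : FreeMonoid α, a.length = n →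
      ∃ a₀, (∃ k : ℕ, a = a₀ * p ^ k) ∧ ∀ c, a₀ ≠ c * p from h _ a rfl
  intro n
  induction n using Nat.strong_induction_on with
  | _ n ih =>
    intro a ha
    by_cases hc : ∀ c, a ≠ c * p
    · exact ⟨a, ⟨0, by simp⟩, hc⟩
    push Not at hc
    obtain ⟨c, hc⟩ := hc
    have hlt : c.length < n := by
      have := length_pos hp
      rw [← ha, hc, length_mul]
      omega
    obtain ⟨a₀, ⟨k, hk⟩, h⟩ := ih _ hlt c rfl
    exact ⟨a₀, ⟨k + 1, by rw [hc, hk, pow_succ, mul_assoc]⟩, h⟩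

open Classical in
/-- The word `a` with all trailing copies of `p` removed. -/
noncomputable def stem (p a : FreeMonoid α) : FreeMonoid α :=
  if hp : p ≠ 1 then (exists_stem hp a).choose else 1

theorem eq_stem_mul_pow {p : FreeMonoid α} (hp : p ≠ 1) (a : FreeMonoid α) :
    ∃ k : ℕ, a = stem p a * p ^ k := by
  rw [stem, dif_pos hp]
  exact (exists_stem hp a).choose_spec.1

theorem stem_ne {p : FreeMonoid α} (hp : p ≠ 1) (a c : FreeMonoid α) : stem p a ≠ c * p := by
  rw [stem, dif_pos hp]
  exact (exists_stem hp a).choose_spec.2 c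

theorem stem_mul_pow {p : FreeMonoid α} (hp : p ≠ 1) (a : FreeMonoid α) (k : ℕ) :
    stem p (a * p ^ k) = stem p a := by
  have key : ∀ (b c : FreeMonoid α) (i j : ℕ), i ≤ j → b * p ^ i = c * p ^ j →
      (∀ d, b ≠ d * p) → b = c := by
    intro b c i j hij h hb
    obtain ⟨m, rfl⟩ := Nat.exists_eq_add_of_le' hij
    rw [pow_add, ← mul_assoc] at h
    have h' := mul_right_cancel h
    cases m with
    | zero => simpa using h'
    | succ m => exact absurd (by rw [h', pow_succ, mul_assoc]) (hb (c * p ^ m))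
  obtain ⟨i, hi⟩ := eq_stem_mul_pow hp a
  obtain ⟨j, hj⟩ := eq_stem_mul_pow hp (a * p ^ k)
  have h : stem p (a * p ^ k) * p ^ j = stem p a * p ^ (i + k) := by
    rw [← hj, pow_add, ← mul_assoc, ← hi]
  rcases le_total j (i + k) with hle | hle
  · exact key _ _ _ _ hle h (stem_ne hp _)
  · exact (key _ _ _ _ hle h.symm (stem_ne hp _)).symm

theorem reverse_injective : Function.Injective (reverse : FreeMonoid α → FreeMonoid α) :=
  fun a b h => by rw [← reverse_reverse (a := a), h, reverse_reverse]

/-! ### Counting the products a x b. -/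

variable [DecidableEq (FreeMonoid α)]

/-- The set of all words `a * x * b` with `a ∈ P` and `b ∈ Q`. -/
def sandwich (P : Finset (FreeMonoid α)) (x : FreeMonoid α) (Q : Finset (FreeMonoid α)) :
    Finset (FreeMonoid α) :=
  (P ×ˢ Q).image fun z => z.1 * x * z.2

/-- Three representations of one word have left factors a, a u, a u v, and the overlapping copies of
x make u and v periods of x. If this is excluded, (a, b) ↦ a x b is at most two-to-one. -/
theorem card_mul_card_le_two_mul_sandwich (P Q : Finset (FreeMonoid α)) (x : FreeMonoid α)
    (hP : ∀ a ∈ P, a.length ≤ x.length)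
    (h : ∀ a u v : FreeMonoid α, a ∈ P → a * u ∈ P → a * u * v ∈ P → IsPeriod u x →
      IsPeriod v x → u.length + v.length ≤ x.length → False) :
    P.card * Q.card ≤ 2 * (sandwich P x Q).card := by
  rw [← Finset.card_product]
  refine Finset.card_le_mul_card_image _ 2 fun w _ => ?_
  by_contra hcon
  obtain ⟨y₁, h₁, y₂, h₂, y₃, h₃, h12, h13, h23⟩ := Finset.two_lt_card.1 (not_le.1 hcon)
  simp only [Finset.mem_filter, Finset.mem_product] at h₁ h₂ h₃
  have step : ∀ y z : FreeMonoid α × FreeMonoid α, y ≠ z → y.1 * x * y.2 = z.1 * x * z.2 →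
      y.1.length ≤ z.1.length → ∃ u, z.1 = y.1 * u ∧ IsPeriod u x := by
    intro y z hne he hl
    obtain ⟨u, hu, hu'⟩ := levi (show y.1 * (x * y.2) = z.1 * (x * z.2) by
      simpa [mul_assoc] using he) hl
    refine ⟨u, hu, isPeriod_of_mul_eq ?_ (by rw [hu', mul_assoc])⟩
    rintro rfl
    have e1 : z.1 = y.1 := by simpa using hu
    have e2 : y.2 = z.2 := by simpa using hu'
    exact hne (Prod.ext e1.symm e2)
  have three : ∀ y z t : FreeMonoid α × FreeMonoid α, y.1 ∈ P → z.1 ∈ P → t.1 ∈ P →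
      y ≠ z → z ≠ t → y.1 * x * y.2 = w → z.1 * x * z.2 = w → t.1 * x * t.2 = w →
      y.1.length ≤ z.1.length → z.1.length ≤ t.1.length → False := by
    intro y z t hy hz ht hyz hzt ey ez et l1 l2
    obtain ⟨u, hu, pu⟩ := step y z hyz (ey.trans ez.symm) l1
    obtain ⟨v, hv, pv⟩ := step z t hzt (ez.trans et.symm) l2
    have hlen := hP _ ht
    refine h y.1 u v hy (hu ▸ hz) (hu ▸ hv ▸ ht) pu pv ?_
    rw [hv, hu, length_mul, length_mul] at hlen
    omega
  obtain ⟨⟨p₁, -⟩, e₁⟩ := h₁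
  obtain ⟨⟨p₂, -⟩, e₂⟩ := h₂
  obtain ⟨⟨p₃, -⟩, e₃⟩ := h₃
  rcases le_total y₁.1.length y₂.1.length with l12 | l12 <;>
  rcases le_total y₂.1.length y₃.1.length with l23 | l23 <;>
  rcases le_total y₁.1.length y₃.1.length with l13 | l13
  · exact three _ _ _ p₁ p₂ p₃ h12 h23 e₁ e₂ e₃ l12 l23
  · exact three _ _ _ p₁ p₂ p₃ h12 h23 e₁ e₂ e₃ l12 l23
  · exact three _ _ _ p₁ p₃ p₂ h13 h23.symm e₁ e₃ e₂ l13 l23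
  · exact three _ _ _ p₃ p₁ p₂ h13.symm h12 e₃ e₁ e₂ l13 l12
  · exact three _ _ _ p₂ p₁ p₃ h12.symm h13 e₂ e₁ e₃ l12 l13
  · exact three _ _ _ p₂ p₃ p₁ h23 h13.symm e₂ e₃ e₁ l23 l13
  · exact three _ _ _ p₃ p₂ p₁ h23.symm h12.symm e₃ e₂ e₁ l23 l12
  · exact three _ _ _ p₃ p₂ p₁ h23.symm h12.symm e₃ e₂ e₁ l23 l12

theorem sandwich_mono {P P' : Finset (FreeMonoid α)} (h : P ⊆ P') (x : FreeMonoid α)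
    (Q : Finset (FreeMonoid α)) : sandwich P x Q ⊆ sandwich P' x Q :=
  Finset.image_subset_image (Finset.product_subset_product_left h)

theorem exists_short_period {P Q : Finset (FreeMonoid α)} {x : FreeMonoid α}
    (hP : ∀ a ∈ P, a.length ≤ x.length)
    (h : 2 * (sandwich P x Q).card < P.card * Q.card) :
    ∃ u, IsPeriod u x ∧ 2 * u.length ≤ x.length := by
  by_contra hcon
  push Not at hcon
  refine absurd (card_mul_card_le_two_mul_sandwich P Q x hP ?_) (not_le.2 h)
  intro a u v _ _ _ hu hv hl
  have := hcon u hu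
  have := hcon v hv
  omega

/-- Keep one element of P per stem. A triple coincidence among these would give a period commuting
with u, hence a power of p, joining two elements with the same stem. -/
theorem card_stem_mul_card_le {P Q : Finset (FreeMonoid α)} {x u p : FreeMonoid α}
    (hP : ∀ a ∈ P, a.length ≤ x.length) (hu : IsPeriod u x) (hul : 2 * u.length ≤ x.length)
    (hp : p ≠ 1) (hroot : ∀ v, Commute v u → ∃ k : ℕ, v = p ^ k) :
    (P.image (stem p)).card * Q.card ≤ 2 * (sandwich P x Q).card := by
  obtain ⟨R, hRP, hinj, hR⟩ := Finset.exists_subset_injOn_image_eq_of_surjOn (f := stem p)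
    (P : Set (FreeMonoid α)) (P.image (stem p)) (by
      rw [Finset.coe_image]; exact Set.surjOn_image _ _)
  rw [← hR, Finset.card_image_of_injOn hinj]
  refine (card_mul_card_le_two_mul_sandwich R Q x (fun a ha => hP a (hRP ha)) ?_).trans
    (Nat.mul_le_mul_left 2 (Finset.card_le_card (sandwich_mono hRP x Q)))
  intro a v w ha hav havw hv hw hl
  have hvu : Commute v u := by
    -- A short v is compared with u directly; if v is long then w is short and serves as an
    -- intermediary.
    rcases le_total (2 * v.length) x.length with h | h
    · exact hv.commute hu (by omega)
    · exact commute_trans hw.1 (hv.commute hw hl) (hu.commute hw (by omega))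
  obtain ⟨k, rfl⟩ := hroot v hvu
  have := hinj ha hav (stem_mul_pow hp a k).symm
  exact hv.1 (by simpa using this)

/-- If both `x` and `y` have few products `a * x * b`, then their short periods commute. -/
theorem short_periods_commute {P Q : Finset (FreeMonoid α)} {x y u v : FreeMonoid α}
    (hPx : ∀ a ∈ P, a.length ≤ x.length) (hPy : ∀ a ∈ P, a.length ≤ y.length)
    (hx : 6 * (sandwich P x Q).card < P.card * Q.card)
    (hy : 6 * (sandwich P y Q).card < P.card * Q.card)
    (hu : IsPeriod u x) (hul : 2 * u.length ≤ x.length)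
    (hv : IsPeriod v y) (hvl : 2 * v.length ≤ y.length) : Commute u v := by
  obtain ⟨p, hp1, hpu, hp⟩ := exists_root hu.1
  obtain ⟨q, hq1, hqv, hq⟩ := exists_root hv.1
  suffices hpq : Commute p q by
    obtain ⟨k, hk⟩ := hp u (Commute.refl u)
    obtain ⟨l, hl⟩ := hq v (Commute.refl v)
    rw [hk, hl]
    exact hpq.pow_pow k l
  have cp := card_stem_mul_card_le (Q := Q) hPx hu hul hp1 hp
  have cq := card_stem_mul_card_le (Q := Q) hPy hv hvl hq1 hq
  -- The factor 6 in the hypothesis, against the 2 in the stem bound, leaves fewer than |P|/3 stems.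
  have cp' : 3 * (P.image (stem p)).card < P.card := by
    by_contra hcon
    nlinarith [Nat.mul_le_mul_right Q.card (not_lt.1 hcon)]
  have cq' : 3 * (P.image (stem q)).card < P.card := by
    by_contra hcon
    nlinarith [Nat.mul_le_mul_right Q.card (not_lt.1 hcon)]
  clear cp cq hp hq hx hy
  have key : ∀ p q : FreeMonoid α, p ≠ 1 → q ≠ 1 → 3 * (P.image (stem p)).card < P.card →
      3 * (P.image (stem q)).card < P.card → p.length ≤ q.length → Commute p q := by
    intro p q hp1 hq1 hp hq hl
    classical
    set T := P.filter fun a => ∃ c, a = c * (q * q) with hT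
    -- A word of P not ending in q q is its q-stem times 1 or q, so T has more than |P|/3 elements.
    -- Two of them share a p-stem, hence differ by a power of p.
    have hcard : P.card ≤ T.card + 2 * (P.image (stem q)).card := by
      have hsub : P ⊆ T ∪ (P.image (stem q) ∪ (P.image (stem q)).image (· * q)) := by
        intro a ha
        obtain ⟨k, hk⟩ := eq_stem_mul_pow hq1 a
        have hm := Finset.mem_image_of_mem (stem q) ha
        match k, hk with
        | 0, hk =>
          have : a = stem q a := by simpa using hk
          exact Finset.mem_union_right _ (Finset.mem_union_left _ (this ▸ hm))
        | 1, hk =>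
          refine Finset.mem_union_right _ (Finset.mem_union_right _
            (Finset.mem_image.2 ⟨_, hm, ?_⟩))
          simpa using hk.symm
        | k + 2, hk =>
          refine Finset.mem_union_left _ (Finset.mem_filter.2 ⟨ha, stem q a * q ^ k, ?_⟩)
          rw [mul_assoc, ← pow_two, ← pow_add]
          exact hk
      have h1 := Finset.card_le_card hsub
      have h2 := Finset.card_union_le T (P.image (stem q) ∪ (P.image (stem q)).image (· * q))
      have h3 := Finset.card_union_le (P.image (stem q)) ((P.image (stem q)).image (· * q))
      have h4 := Finset.card_image_le (s := P.image (stem q)) (f := (· * q))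
      omega
    obtain ⟨a, ha, b, hb, hne, hab⟩ := Finset.exists_ne_map_eq_of_card_lt_of_maps_to
      (s := T) (t := P.image (stem p)) (by omega) (f := stem p)
      (fun a ha => Finset.mem_coe.2 (Finset.mem_image_of_mem _ (Finset.mem_filter.1 ha).1))
    obtain ⟨c, hc⟩ := (Finset.mem_filter.1 ha).2
    obtain ⟨d, hd⟩ := (Finset.mem_filter.1 hb).2
    obtain ⟨i, hi⟩ := eq_stem_mul_pow hp1 a
    obtain ⟨j, hj⟩ := eq_stem_mul_pow hp1 b
    have fin : ∀ (a b c d : FreeMonoid α) (i j : ℕ), a ≠ b → stem p a = stem p b → i ≤ j →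
        a = stem p a * p ^ i → b = stem p b * p ^ j → a = c * (q * q) → b = d * (q * q) →
        Commute p q := by
      intro a b c d i j hne hab hij hi hj hc hd
      obtain ⟨m, rfl⟩ := Nat.exists_eq_add_of_le hij
      have hb : b = a * p ^ m := by rw [hj, ← hab, pow_add, ← mul_assoc, ← hi]
      refine commute_of_sq_suffix hp1 (k := m) ?_ hl hc (hb ▸ hd)
      rintro rfl
      exact hne (by simpa using hb.symm)
    rcases le_total i j with hij | hij
    · exact fin a b c d i j hne hab hij hi hj hc hd
    · exact fin b a d c j i hne.symm hab.symm hij hj hi hd hc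
  rcases le_total p.length q.length with hl | hl
  · exact key p q hp1 hq1 cp' cq' hl
  · exact (key q p hq1 hp1 cq' cp' hl).symm

theorem card_sandwich_reverse (P Q : Finset (FreeMonoid α)) (x : FreeMonoid α) :
    (sandwich (Q.image reverse) x.reverse (P.image reverse)).card = (sandwich P x Q).card := by
  rw [← Finset.card_image_of_injective (sandwich P x Q) reverse_injective]
  congr 1
  ext w
  simp only [sandwich, Finset.mem_image, Finset.mem_product, Prod.exists]
  constructor
  · rintro ⟨_, _, ⟨⟨b, hb, rfl⟩, a, ha, rfl⟩, rfl⟩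
    exact ⟨_, ⟨a, b, ⟨ha, hb⟩, rfl⟩, by simp [reverse_mul, mul_assoc]⟩
  · rintro ⟨_, ⟨a, b, ⟨ha, hb⟩, rfl⟩, rfl⟩
    exact ⟨_, _, ⟨⟨b, hb, rfl⟩, a, ha, rfl⟩, by simp [reverse_mul, mul_assoc]⟩

/-- If all the sets `P * x * P` with `x ∈ X` are small, the words in `X` are periodic with a
common period and a common phase. -/
theorem exists_common_period {P X : Finset (FreeMonoid α)} {x₀ : FreeMonoid α} (hx₀ : x₀ ∈ X)
    (hl : ∀ a ∈ P, ∀ x ∈ X, a.length ≤ x.length)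
    (h : ∀ x ∈ X, 6 * (sandwich P x P).card < P.card * P.card) :
    ∃ u, u ≠ 1 ∧ ∀ y ∈ X, ∃ k : ℕ, k ≠ 0 ∧ ∃ c, u ^ k * x₀ = x₀ * c ∧ u ^ k * y = y * c := by
  have short : ∀ x ∈ X, ∃ u, IsPeriod u x ∧ 2 * u.length ≤ x.length := fun x hx =>
    exists_short_period (P := P) (Q := P) (fun a ha => hl a ha x hx) (by have := h x hx; omega)
  obtain ⟨u, hu, hul⟩ := short x₀ hx₀
  refine ⟨u, hu.1, fun y hy => ?_⟩
  obtain ⟨v, hv, hvl⟩ := short y hy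
  have huv : Commute u v := short_periods_commute (fun a ha => hl a ha _ hx₀)
    (fun a ha => hl a ha _ hy) (h _ hx₀) (h _ hy) hu hul hv hvl
  obtain ⟨c, hc⟩ := hu.2
  obtain ⟨d, hd⟩ := hv.2
  have lenc : c.length = u.length := by
    have := congrArg length hc
    simp only [length_mul] at this
    omega
  have lend : d.length = v.length := by
    have := congrArg length hd
    simp only [length_mul] at this
    omega
  have hrev : ∀ {w z e : FreeMonoid α}, IsPeriod w z → w * z = z * e →
      IsPeriod e.reverse z.reverse := by
    intro w z e hw he
    refine ⟨?_, w.reverse, by rw [← reverse_mul, ← he, reverse_mul]⟩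
    intro h0
    have h1 := congrArg length he
    have h2 := congrArg length h0
    have := length_pos hw.1
    simp only [length_mul, length_reverse, length_one] at h1 h2
    omega
  have hlr : ∀ z ∈ X, ∀ a ∈ P.image reverse, a.length ≤ z.reverse.length := by
    intro z hz a ha
    obtain ⟨b, hb, rfl⟩ := Finset.mem_image.1 ha
    simpa [length_reverse] using hl b hb z hz
  have hr : ∀ z ∈ X, 6 * (sandwich (P.image reverse) z.reverse (P.image reverse)).card <
      (P.image reverse).card * (P.image reverse).card := by
    intro z hz
    rw [card_sandwich_reverse, Finset.card_image_of_injective P reverse_injective]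
    exact h z hz
  -- Left periods determine the period but not the phase; the reversed words supply commutation of
  -- the right periods c and d.
  have hcd' : Commute c.reverse d.reverse := short_periods_commute (hlr _ hx₀) (hlr _ hy)
    (hr _ hx₀) (hr _ hy) (hrev hu hc) (by simpa [length_reverse, lenc] using hul) (hrev hv hd)
    (by simpa [length_reverse, lend] using hvl)
  have hcd : Commute c d := by
    have := hcd'.eq
    rw [← reverse_mul, ← reverse_mul] at this
    exact (reverse_injective this).symm
  -- These exponents equalize the lengths, and commuting words of equal length coincide.
  have e1 : u ^ v.length = v ^ u.length := commute_of_eq_length (huv.pow_pow _ _)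
    (by rw [length_pow, length_pow, mul_comm])
  have e2 : c ^ v.length = d ^ u.length := commute_of_eq_length (hcd.pow_pow _ _)
    (by rw [length_pow, length_pow, lenc, lend, mul_comm])
  have semi : ∀ {w z e : FreeMonoid α} (n : ℕ), w * z = z * e → w ^ n * z = z * e ^ n :=
    fun n he => ((show SemiconjBy _ _ _ from he.symm).pow_right n).eq.symm
  exact ⟨v.length, (length_pos hv.1).ne', c ^ v.length, semi _ hc, by
    rw [e1, e2]; exact semi _ hd⟩

end FreeMonoid

/-! ### Words as nonnegative matrices in SL(2,ℤ). -/

namespace ModularGrowth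

open FreeMonoid ModularGroup

theorem mul_entries (g h : SL(2, ℤ)) :
    (g * h) 0 0 = g 0 0 * h 0 0 + g 0 1 * h 1 0 ∧ (g * h) 0 1 = g 0 0 * h 0 1 + g 0 1 * h 1 1 ∧
    (g * h) 1 0 = g 1 0 * h 0 0 + g 1 1 * h 1 0 ∧ (g * h) 1 1 = g 1 0 * h 0 1 + g 1 1 * h 1 1 := by
  simp [Matrix.mul_apply, Fin.sum_univ_two]

theorem det_entries (g : SL(2, ℤ)) : g 0 0 * g 1 1 - g 0 1 * g 1 0 = 1 := by
  rw [← Matrix.det_fin_two, g.2]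

theorem inv_entries (g : SL(2, ℤ)) :
    g⁻¹ 0 0 = g 1 1 ∧ g⁻¹ 0 1 = -g 0 1 ∧ g⁻¹ 1 0 = -g 1 0 ∧ g⁻¹ 1 1 = g 0 0 := by
  simp [Matrix.SpecialLinearGroup.coe_inv, Matrix.adjugate_fin_two]

theorem neg_entries (g : SL(2, ℤ)) (i j : Fin 2) : (-g) i j = -g i j := by
  simp

theorem ext_entries {g h : SL(2, ℤ)} (h00 : g 0 0 = h 0 0) (h01 : g 0 1 = h 0 1)
    (h10 : g 1 0 = h 1 0) (h11 : g 1 1 = h 1 1) : g = h := by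
  ext i j
  fin_cases i <;> fin_cases j <;> assumption

theorem S_entries : S 0 0 = 0 ∧ S 0 1 = -1 ∧ S 1 0 = 1 ∧ S 1 1 = 0 := by
  simp [coe_S]

/-- The two elementary matrices generating the monoid of nonnegative matrices. -/
def letter : Bool → SL(2, ℤ)
  | true => ⟨!![1, 0; 1, 1], by simp⟩
  | false => ⟨!![1, 1; 0, 1], by simp⟩

/-- The matrix of a word in the two elementary matrices. -/
def mat : FreeMonoid Bool →* SL(2, ℤ) := FreeMonoid.lift letter

theorem letter_mul_entries_true (g : SL(2, ℤ)) :
    (letter true * g) 0 0 = g 0 0 ∧ (letter true * g) 0 1 = g 0 1 ∧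
    (letter true * g) 1 0 = g 0 0 + g 1 0 ∧ (letter true * g) 1 1 = g 0 1 + g 1 1 := by
  obtain ⟨h1, h2, h3, h4⟩ := mul_entries (letter true) g
  rw [h1, h2, h3, h4]
  simp [letter]

theorem letter_mul_entries_false (g : SL(2, ℤ)) :
    (letter false * g) 0 0 = g 0 0 + g 1 0 ∧ (letter false * g) 0 1 = g 0 1 + g 1 1 ∧
    (letter false * g) 1 0 = g 1 0 ∧ (letter false * g) 1 1 = g 1 1 := by
  obtain ⟨h1, h2, h3, h4⟩ := mul_entries (letter false) g
  rw [h1, h2, h3, h4]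
  simp [letter]

theorem mat_of_mul (l : Bool) (w : FreeMonoid Bool) : mat (of l * w) = letter l * mat w := by
  simp [mat]

/-- A matrix with nonnegative entries. -/
def Nonneg (g : SL(2, ℤ)) : Prop := 0 ≤ g 0 0 ∧ 0 ≤ g 0 1 ∧ 0 ≤ g 1 0 ∧ 0 ≤ g 1 1

theorem Nonneg.row_pos {g : SL(2, ℤ)} (hg : Nonneg g) :
    0 < g 0 0 + g 0 1 ∧ 0 < g 1 0 + g 1 1 := by
  obtain ⟨h1, h2, h3, h4⟩ := hg
  have hd := det_entries g
  constructor
  · by_contra hcon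
    have e1 : g 0 0 = 0 := by omega
    have e2 : g 0 1 = 0 := by omega
    rw [e1, e2] at hd
    omega
  · by_contra hcon
    have e1 : g 1 0 = 0 := by omega
    have e2 : g 1 1 = 0 := by omega
    rw [e1, e2] at hd
    omega

theorem mat_nonneg_and_length (w : FreeMonoid Bool) : Nonneg (mat w) ∧
    (w.length : ℤ) + 2 ≤ mat w 0 0 + mat w 0 1 + mat w 1 0 + mat w 1 1 := by
  induction w using FreeMonoid.inductionOn' with
  | one => simp [Nonneg]
  | of_mul l w ih =>
    obtain ⟨hn, hl⟩ := ih
    have hr := hn.row_pos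
    obtain ⟨h1, h2, h3, h4⟩ := hn
    rw [mat_of_mul, length_mul, length_of]
    push_cast
    unfold Nonneg
    cases l
    · obtain ⟨e1, e2, e3, e4⟩ := letter_mul_entries_false (mat w)
      rw [e1, e2, e3, e4]
      omega
    · obtain ⟨e1, e2, e3, e4⟩ := letter_mul_entries_true (mat w)
      rw [e1, e2, e3, e4]
      omega

theorem mat_nonneg (w : FreeMonoid Bool) : Nonneg (mat w) := (mat_nonneg_and_length w).1

theorem length_le_entries (w : FreeMonoid Bool) :
    (w.length : ℤ) + 2 ≤ mat w 0 0 + mat w 0 1 + mat w 1 0 + mat w 1 1 :=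
  (mat_nonneg_and_length w).2

theorem mat_eq_one {w : FreeMonoid Bool} (h : mat w = 1) : w = 1 := by
  have := length_le_entries w
  rw [h] at this
  have h1 : (w.length : ℤ) + 2 ≤ 1 + 0 + 0 + 1 := this
  exact length_eq_zero.1 (by omega)

/-- On the left the lower row has the strictly larger sum, on the right the upper row sum is at
least the lower. Hence the first letter of a word can be read off its matrix. -/
theorem letter_true_mul_ne {g h : SL(2, ℤ)} (hg : Nonneg g) (hh : Nonneg h) :
    letter true * g ≠ letter false * h := by
  intro he
  obtain ⟨e1, e2, e3, e4⟩ := letter_mul_entries_true g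
  obtain ⟨f1, f2, f3, f4⟩ := letter_mul_entries_false h
  rw [he] at e1 e2 e3 e4
  have := hg.row_pos
  obtain ⟨a1, a2, a3, a4⟩ := hg
  obtain ⟨b1, b2, b3, b4⟩ := hh
  omega

theorem mat_injective : Function.Injective mat := by
  intro w
  induction w using FreeMonoid.inductionOn' with
  | one => exact fun v h => (mat_eq_one (by rw [← h, map_one])).symm
  | of_mul l w ih =>
    intro v h
    induction v using FreeMonoid.inductionOn' with
    | one => exact mat_eq_one (by rw [h, map_one])
    | of_mul k v _ =>
      rw [mat_of_mul, mat_of_mul] at h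
      cases l <;> cases k
      · rw [ih (mul_left_cancel h)]
      · exact absurd h.symm (letter_true_mul_ne (mat_nonneg _) (mat_nonneg _))
      · exact absurd h (letter_true_mul_ne (mat_nonneg _) (mat_nonneg _))
      · rw [ih (mul_left_cancel h)]

theorem mat_ne_neg (v w : FreeMonoid Bool) : mat v ≠ -mat w := by
  intro h
  have h0 := (mat_nonneg v).row_pos
  have h1 := (mat_nonneg w).row_pos
  rw [h, neg_entries, neg_entries] at h0
  omega

/-- The Euclidean algorithm on rows: subtract a row from one that dominates it. When neither
dominates, determinant 1 leaves only the identity. -/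
theorem exists_mat_eq {g : SL(2, ℤ)} (hg : Nonneg g) : ∃ w, mat w = g := by
  suffices h : ∀ n : ℕ, ∀ g : SL(2, ℤ), Nonneg g →
      (g 0 0 + g 0 1 + g 1 0 + g 1 1).toNat = n → ∃ w, mat w = g from h _ g hg rfl
  intro n
  induction n using Nat.strong_induction_on with
  | _ n ih =>
    intro g hg hn
    have hr := hg.row_pos
    have hd := det_entries g
    obtain ⟨h1, h2, h3, h4⟩ := hg
    by_cases hF : g 1 0 ≤ g 0 0 ∧ g 1 1 ≤ g 0 1
    · obtain ⟨h, rfl⟩ : ∃ h, g = letter false * h := ⟨(letter false)⁻¹ * g, by simp⟩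
      obtain ⟨f1, f2, f3, f4⟩ := letter_mul_entries_false h
      obtain ⟨w, hw⟩ := ih _ (by rw [← hn]; omega) h ⟨by omega, by omega, by omega, by omega⟩ rfl
      exact ⟨of false * w, by rw [mat_of_mul, hw]⟩
    by_cases hT : g 0 0 ≤ g 1 0 ∧ g 0 1 ≤ g 1 1
    · obtain ⟨h, rfl⟩ : ∃ h, g = letter true * h := ⟨(letter true)⁻¹ * g, by simp⟩
      obtain ⟨f1, f2, f3, f4⟩ := letter_mul_entries_true h
      obtain ⟨w, hw⟩ := ih _ (by rw [← hn]; omega) h ⟨by omega, by omega, by omega, by omega⟩ rfl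
      exact ⟨of true * w, by rw [mat_of_mul, hw]⟩
    refine ⟨1, ?_⟩
    have hcase : (g 1 0 + 1 ≤ g 0 0 ∧ g 0 1 + 1 ≤ g 1 1) ∨
        (g 0 0 + 1 ≤ g 1 0 ∧ g 1 1 + 1 ≤ g 0 1) := by omega
    rcases hcase with ⟨ha, hb⟩ | ⟨ha, hb⟩
    · have hz : g 0 1 + g 1 0 ≤ 0 := by
        nlinarith [mul_le_mul ha hb (by omega) h1]
      have e1 : g 0 1 = 0 := by omega
      have e2 : g 1 0 = 0 := by omega
      rw [e1, e2, zero_mul, sub_zero] at hd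
      rcases Int.eq_one_or_neg_one_of_mul_eq_one' hd with ⟨e3, e4⟩ | ⟨e3, e4⟩
      · rw [map_one]
        exact ext_entries (by simp [e3]) (by simp [e1]) (by simp [e2]) (by simp [e4])
      · omega
    · nlinarith [mul_le_mul ha hb (by omega) h3]

/-- Up to sign, the matrix of a word. -/
def IsWord (g : SL(2, ℤ)) : Prop := ∃ w, g = mat w ∨ g = -mat w

theorem isWord_of_nonneg {g : SL(2, ℤ)} (h : Nonneg g ∨ Nonneg (-g)) : IsWord g := by
  rcases h with h | h
  · obtain ⟨w, hw⟩ := exists_mat_eq h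
    exact ⟨w, Or.inl hw.symm⟩
  · obtain ⟨w, hw⟩ := exists_mat_eq h
    exact ⟨w, Or.inr (by rw [hw, neg_neg])⟩

theorem S_inv : S⁻¹ = -S := by
  obtain ⟨h1, h2, h3, h4⟩ := inv_entries S
  obtain ⟨e1, e2, e3, e4⟩ := S_entries
  exact ext_entries (by simp [h1]) (by simp [h2]) (by simp [h3]) (by simp [h4])

theorem mul_S_inv_entries (g : SL(2, ℤ)) :
    (g * S⁻¹) 0 0 = -g 0 1 ∧ (g * S⁻¹) 0 1 = g 0 0 ∧
    (g * S⁻¹) 1 0 = -g 1 1 ∧ (g * S⁻¹) 1 1 = g 1 0 := by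
  obtain ⟨h1, h2, h3, h4⟩ := mul_entries g S⁻¹
  obtain ⟨i1, i2, i3, i4⟩ := inv_entries S
  obtain ⟨e1, e2, e3, e4⟩ := S_entries
  rw [h1, h2, h3, h4, i1, i2, i3, i4, e1, e2, e3, e4]
  refine ⟨by ring, by ring, by ring, by ring⟩

theorem S_inv_mul_entries (g : SL(2, ℤ)) :
    (S⁻¹ * g) 0 0 = g 1 0 ∧ (S⁻¹ * g) 0 1 = g 1 1 ∧
    (S⁻¹ * g) 1 0 = -g 0 0 ∧ (S⁻¹ * g) 1 1 = -g 0 1 := by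
  obtain ⟨h1, h2, h3, h4⟩ := mul_entries S⁻¹ g
  obtain ⟨i1, i2, i3, i4⟩ := inv_entries S
  obtain ⟨e1, e2, e3, e4⟩ := S_entries
  rw [h1, h2, h3, h4, i1, i2, i3, i4, e1, e2, e3, e4]
  refine ⟨by ring, by ring, by ring, by ring⟩

/-- The four relative positions of an edge of the tree with respect to the base edge. -/
theorem isWord_cases (g : SL(2, ℤ)) :
    IsWord g ∨ IsWord (S⁻¹ * g * S) ∨ IsWord (g * S⁻¹) ∨ IsWord (S⁻¹ * g) := by
  have hd := det_entries g
  have hS : S⁻¹ * g * S = -(S⁻¹ * g * S⁻¹) := by rw [S_inv]; simp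
  have conj : (S⁻¹ * g * S) 0 0 = g 1 1 ∧ (S⁻¹ * g * S) 0 1 = -g 1 0 ∧
      (S⁻¹ * g * S) 1 0 = -g 0 1 ∧ (S⁻¹ * g * S) 1 1 = g 0 0 := by
    obtain ⟨h1, h2, h3, h4⟩ := mul_S_inv_entries (S⁻¹ * g)
    obtain ⟨e1, e2, e3, e4⟩ := S_inv_mul_entries g
    rw [hS, neg_entries, neg_entries, neg_entries, neg_entries, h1, h2, h3, h4, e1, e2, e3, e4]
    simp
  have pos : ∀ x y : ℤ, 1 ≤ x * y → (0 ≤ x ∧ 0 ≤ y) ∨ (x ≤ 0 ∧ y ≤ 0) := by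
    intro x y h
    rcases le_total 0 x with hx | hx <;> rcases le_total 0 y with hy | hy
    · exact Or.inl ⟨hx, hy⟩
    · nlinarith
    · nlinarith
    · exact Or.inr ⟨hx, hy⟩
  have pos' : ∀ x y : ℤ, 0 ≤ x * y → (0 ≤ x ∧ 0 ≤ y) ∨ (x ≤ 0 ∧ y ≤ 0) := by
    intro x y h
    exact mul_nonneg_iff.1 h
  -- By the determinant, either both products of opposite entries are nonnegative or both are
  -- nonpositive. The signs then decide the case.
  rcases le_or_gt 1 (g 0 0 * g 1 1) with hpos | hneg
  · have hbc : 0 ≤ g 0 1 * g 1 0 := by omega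
    rcases pos _ _ hpos with hA | hA <;> rcases pos' _ _ hbc with hB | hB
    · exact Or.inl (isWord_of_nonneg (Or.inl (by unfold Nonneg; omega)))
    · exact Or.inr (Or.inl (isWord_of_nonneg (Or.inl (by unfold Nonneg; omega))))
    · refine Or.inr (Or.inl (isWord_of_nonneg (Or.inr ?_)))
      unfold Nonneg
      simp only [neg_entries]
      omega
    · refine Or.inl (isWord_of_nonneg (Or.inr ?_))
      unfold Nonneg
      simp only [neg_entries]
      omega
  · have hbc : 1 ≤ g 0 1 * (-g 1 0) := by rw [mul_neg]; omega
    have had : 0 ≤ g 0 0 * (-g 1 1) := by rw [mul_neg]; omega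
    obtain ⟨a1, a2, a3, a4⟩ := mul_S_inv_entries g
    obtain ⟨b1, b2, b3, b4⟩ := S_inv_mul_entries g
    rcases pos _ _ hbc with hA | hA <;> rcases pos' _ _ had with hB | hB
    · refine Or.inr (Or.inr (Or.inr (isWord_of_nonneg (Or.inr ?_))))
      unfold Nonneg
      simp only [neg_entries]
      omega
    · refine Or.inr (Or.inr (Or.inl (isWord_of_nonneg (Or.inr ?_))))
      unfold Nonneg
      simp only [neg_entries]
      omega
    · exact Or.inr (Or.inr (Or.inl (isWord_of_nonneg (Or.inl (by unfold Nonneg; omega)))))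
    · exact Or.inr (Or.inr (Or.inr (isWord_of_nonneg (Or.inl (by unfold Nonneg; omega)))))

/-- Conjugation by `S` turns inverses of words into words (their transposes). -/
theorem exists_flip (w : FreeMonoid Bool) : ∃ w', S * (mat w)⁻¹ * S⁻¹ = mat w' ∧
    S⁻¹ * (mat w)⁻¹ * S = mat w' := by
  have h2 : S⁻¹ * (mat w)⁻¹ * S = S * (mat w)⁻¹ * S⁻¹ := by rw [S_inv]; simp
  obtain ⟨w', hw'⟩ : ∃ w', mat w' = S⁻¹ * (mat w)⁻¹ * S := by
    refine exists_mat_eq ?_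
    have h3 : S⁻¹ * (mat w)⁻¹ * S = -(S⁻¹ * (mat w)⁻¹ * S⁻¹) := by rw [S_inv]; simp
    obtain ⟨h1, h2, h3', h4⟩ := mul_S_inv_entries (S⁻¹ * (mat w)⁻¹)
    obtain ⟨e1, e2, e3, e4⟩ := S_inv_mul_entries (mat w)⁻¹
    obtain ⟨i1, i2, i3, i4⟩ := inv_entries (mat w)
    obtain ⟨n1, n2, n3, n4⟩ := mat_nonneg w
    rw [h3]
    unfold Nonneg
    simp only [neg_entries, h1, h2, h3', h4, e1, e2, e3, e4, i1, i2, i3, i4]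
    omega
  exact ⟨w', by rw [hw', h2], hw'.symm⟩

/-! ### Commutation, centralizers and their normalizers. -/

/-- Two matrices commute when their trace-free parts, with coordinates (b, c, a - d), are
proportional; these are the vanishing minors. -/
theorem commute_iff (g h : SL(2, ℤ)) : Commute g h ↔
    g 0 1 * h 1 0 = h 0 1 * g 1 0 ∧
    g 0 1 * (h 0 0 - h 1 1) = h 0 1 * (g 0 0 - g 1 1) ∧
    g 1 0 * (h 0 0 - h 1 1) = h 1 0 * (g 0 0 - g 1 1) := by
  obtain ⟨a1, a2, a3, a4⟩ := mul_entries g h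
  obtain ⟨b1, b2, b3, b4⟩ := mul_entries h g
  constructor
  · intro hc
    rw [hc.eq] at a1 a2 a3 a4
    refine ⟨by linarith, by linarith, by linarith⟩
  · rintro ⟨h1, h2, h3⟩
    refine ext_entries ?_ ?_ ?_ ?_
    · rw [a1, b1]; linarith
    · rw [a2, b2]; linarith
    · rw [a3, b3]; linarith
    · rw [a4, b4]; linarith

/-- Commuting is transitive through noncentral elements. -/
theorem commute_of_commute {u g h : SL(2, ℤ)} (hu : u ≠ 1) (hu' : u ≠ -1) (hg : Commute g u)
    (hh : Commute h u) : Commute g h := by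
  rw [commute_iff] at *
  obtain ⟨g1, g2, g3⟩ := hg
  obtain ⟨h1, h2, h3⟩ := hh
  have hne : u 0 1 ≠ 0 ∨ u 1 0 ≠ 0 ∨ u 0 0 - u 1 1 ≠ 0 := by
    by_contra hcon
    push Not at hcon
    obtain ⟨e1, e2, e3⟩ := hcon
    have hd := det_entries u
    have e4 : u 0 0 = u 1 1 := by omega
    rw [e1, e4, zero_mul, sub_zero] at hd
    rcases Int.eq_one_or_neg_one_of_mul_eq_one' hd with ⟨e5, -⟩ | ⟨e5, -⟩
    · exact hu (ext_entries (by simp [e4, e5]) (by simp [e1]) (by simp [e2]) (by simp [e5]))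
    · exact hu' (ext_entries (by simp [e4, e5]) (by simp [e1]) (by simp [e2]) (by simp [e5]))
  generalize g 0 0 - g 1 1 = a at *
  generalize h 0 0 - h 1 1 = b at *
  generalize u 0 0 - u 1 1 = c at *
  rcases hne with h0 | h0 | h0
  · have k2 : g 0 1 * b = h 0 1 * a :=
      mul_left_cancel₀ h0 (by linear_combination h 0 1 * g2 - g 0 1 * h2)
    exact ⟨mul_left_cancel₀ h0 (by linear_combination h 0 1 * g1 - g 0 1 * h1), k2,
      mul_left_cancel₀ h0 (by linear_combination -b * g1 + a * h1 + u 1 0 * k2)⟩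
  · have k3 : g 1 0 * b = h 1 0 * a :=
      mul_left_cancel₀ h0 (by linear_combination h 1 0 * g3 - g 1 0 * h3)
    exact ⟨mul_left_cancel₀ h0 (by linear_combination h 1 0 * g1 - g 1 0 * h1),
      mul_left_cancel₀ h0 (by linear_combination b * g1 - a * h1 + u 0 1 * k3), k3⟩
  · have k3 : g 1 0 * b = h 1 0 * a :=
      mul_left_cancel₀ h0 (by linear_combination b * g3 - a * h3)
    exact ⟨mul_left_cancel₀ h0 (by linear_combination h 1 0 * g2 - g 1 0 * h2 - u 0 1 * k3),
      mul_left_cancel₀ h0 (by linear_combination b * g2 - a * h2), k3⟩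

theorem relIndex_ne_zero_of_separating {G T : Type*} [Group G] {H K : Subgroup G} (f : G → T)
    (hf : (f '' K).Finite) (h : ∀ a ∈ K, ∀ b ∈ K, f a = f b → a⁻¹ * b ∈ H) :
    H.relIndex K ≠ 0 := by
  rw [Subgroup.relIndex, ← Subgroup.finiteIndex_iff, Subgroup.finiteIndex_iff_finite_quotient]
  have := hf.to_subtype
  refine Finite.of_injective
    (fun q : K ⧸ H.subgroupOf K => (⟨f q.out, q.out, q.out.2, rfl⟩ : f '' K)) ?_
  intro q r hqr
  have h1 := h _ q.out.2 _ r.out.2 (congrArg Subtype.val hqr)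
  rw [← Quotient.out_eq' q, ← Quotient.out_eq' r]
  exact QuotientGroup.eq.2 (Subgroup.mem_subgroupOf.2 h1)

theorem mem_centralizer_singleton {G : Type*} [Group G] {g u : G} :
    g ∈ Subgroup.centralizer {u} ↔ Commute g u :=
  Subgroup.mem_centralizer_singleton_iff

/-- `u` has infinite order modulo `±1` and generates its centralizer up to sign. -/
structure IsRoot (u : SL(2, ℤ)) : Prop where
  exists_zpow : ∀ g, Commute g u → ∃ k : ℤ, g = u ^ k ∨ g = -u ^ k
  eq_zero : ∀ k : ℤ, u ^ k = 1 ∨ u ^ k = -1 → k = 0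

theorem IsRoot.ne_one {u : SL(2, ℤ)} (hu : IsRoot u) : u ≠ 1 := fun h =>
  one_ne_zero (hu.eq_zero 1 (Or.inl (by rw [zpow_one, h])))

theorem IsRoot.ne_neg_one {u : SL(2, ℤ)} (hu : IsRoot u) : u ≠ -1 := fun h =>
  one_ne_zero (hu.eq_zero 1 (Or.inr (by rw [zpow_one, h])))

theorem conj_neg (h g : SL(2, ℤ)) : h⁻¹ * -g * h = -(h⁻¹ * g * h) := by simp

theorem IsRoot.conj {u : SL(2, ℤ)} (hu : IsRoot u) (h : SL(2, ℤ)) : IsRoot (h⁻¹ * u * h) := by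
  have hz : ∀ k : ℤ, (h⁻¹ * u * h) ^ k = h⁻¹ * u ^ k * h := fun k => by
    simpa using conj_zpow (a := h⁻¹) (b := u) (i := k)
  constructor
  · intro g hg
    have hc : Commute (h * g * h⁻¹) u := by
      have h1 : g * (h⁻¹ * u * h) = (h⁻¹ * u * h) * g := hg
      have h2 : (h * g * h⁻¹) * u = h * (g * (h⁻¹ * u * h)) * h⁻¹ := by group
      rw [commute_iff_eq, h2, h1]
      group
    obtain ⟨k, hk⟩ := hu.exists_zpow _ hc
    have hgk : g = h⁻¹ * (h * g * h⁻¹) * h := by group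
    refine ⟨k, ?_⟩
    rw [hz]
    rcases hk with hk | hk <;> rw [hk] at hgk
    · exact Or.inl hgk
    · exact Or.inr (by rw [hgk, conj_neg])
  · intro k hk
    rw [hz] at hk
    refine hu.eq_zero k ?_
    have hgk : u ^ k = h * (h⁻¹ * u ^ k * h) * h⁻¹ := by group
    rcases hk with hk | hk <;> rw [hk] at hgk
    · exact Or.inl (by simpa using hgk)
    · exact Or.inr (by simpa using hgk)

/-- Take p to be the root of w among words. By `isWord_cases`, an element commuting with p is up to
sign a word, the inverse of a word, or of a remaining form that a length count excludes. -/
theorem exists_isRoot_mat {w : FreeMonoid Bool} (hw : w ≠ 1) :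
    ∃ p, Commute p w ∧ IsRoot (mat p) := by
  obtain ⟨p, hp1, hpw, hp⟩ := exists_root hw
  refine ⟨p, hpw, ?_, ?_⟩
  · have hword : ∀ v, Commute (mat v) (mat p) → ∃ k : ℕ, mat v = mat p ^ k := by
      intro v hv
      have hvp : Commute v p := mat_injective (by simpa using hv.eq)
      obtain ⟨k, hk⟩ := hp v (commute_trans hp1 hvp hpw.symm)
      exact ⟨k, by rw [hk, map_pow]⟩
    have hsign : ∀ {g h : SL(2, ℤ)}, g = h ∨ g = -h → Commute g (mat p) →
        Commute h (mat p) := by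
      rintro g h (rfl | rfl) hg
      · exact hg
      · exact (Commute.neg_left_iff).1 hg
    intro g hg
    rcases isWord_cases g with ⟨v, hv⟩ | ⟨v, hv⟩ | ⟨v, hv⟩ | ⟨v, hv⟩
    · obtain ⟨k, hk⟩ := hword v (hsign hv hg)
      exact ⟨k, by rw [zpow_natCast, ← hk]; exact hv⟩
    · obtain ⟨v', h1, -⟩ := exists_flip v
      have hv' : g = (mat v')⁻¹ ∨ g = -(mat v')⁻¹ := by
        have hg' : g = S * (S⁻¹ * g * S) * S⁻¹ := by group
        have h2 : (mat v')⁻¹ = S * mat v * S⁻¹ := by rw [← h1]; group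
        rw [h2]
        rcases hv with hv | hv <;> rw [hv] at hg'
        · exact Or.inl hg'
        · exact Or.inr (by rw [hg']; simp)
      obtain ⟨k, hk⟩ := hword v' (Commute.inv_left_iff.1 (hsign hv' hg))
      exact ⟨-k, by rw [zpow_neg, zpow_natCast, ← hk]; exact hv'⟩
    · exfalso
      obtain ⟨p', h1, -⟩ := exists_flip p
      have hg' : g = mat v * S ∨ g = -(mat v * S) := by
        have hg' : g = (g * S⁻¹) * S := by group
        rcases hv with hv | hv <;> rw [hv] at hg'
        · exact Or.inl hg'
        · exact Or.inr (by rw [hg']; simp)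
      have hc : (mat v * S) * mat p = mat p * (mat v * S) := hsign hg' hg
      -- Moving p across S turns its inverse into the word p', so v would equal a strictly longer
      -- word.
      have he : mat v = mat (p * v * p') := by
        rw [map_mul, map_mul, ← h1]
        calc mat v = (mat v * S) * mat p * (mat p)⁻¹ * S⁻¹ := by group
          _ = _ := by rw [hc]; group
      have := congrArg length (mat_injective he)
      have := length_pos hp1
      simp only [length_mul] at *
      omega
    · exfalso
      have hg' : g = S * mat v ∨ g = -(S * mat v) := by
        have hg' : g = S * (S⁻¹ * g) := by group
        rcases hv with hv | hv <;> rw [hv] at hg'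
        · exact Or.inl hg'
        · exact Or.inr (by rw [hg']; simp)
      have hc : (S * mat v) * mat p = mat p * (S * mat v) := hsign hg' hg
      obtain ⟨p', -, h2⟩ := exists_flip p
      have he : mat v = mat (p' * v * p) := by
        rw [map_mul, map_mul, ← h2]
        calc mat v = S⁻¹ * (mat p)⁻¹ * (mat p * (S * mat v)) := by group
          _ = _ := by rw [← hc]; group
      have := congrArg length (mat_injective he)
      have := length_pos hp1
      simp only [length_mul] at *
      omega
  · have hnat : ∀ n : ℕ, mat p ^ n = 1 ∨ mat p ^ n = -1 → n = 0 := by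
      intro n hn
      rw [← map_pow] at hn
      rcases hn with hn | hn
      · by_contra h0
        exact pow_ne_one hp1 h0 (mat_eq_one hn)
      · exact absurd (by rw [hn, map_one]) (mat_ne_neg (p ^ n) 1)
    intro k hk
    obtain ⟨n, rfl | rfl⟩ := Int.eq_nat_or_neg k
    · rw [zpow_natCast] at hk
      rw [hnat n hk, Nat.cast_zero]
    · rw [zpow_neg, zpow_natCast, inv_eq_one, inv_eq_iff_eq_inv, inv_neg, inv_one] at hk
      rw [hnat n hk, Nat.cast_zero, neg_zero]

theorem IsRoot.relIndex_zpowers {u : SL(2, ℤ)} (hu : IsRoot u) :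
    (Subgroup.zpowers u).relIndex (Subgroup.centralizer {u}) ≠ 0 := by
  refine relIndex_ne_zero_of_separating (fun g => g ∈ Subgroup.zpowers u) (Set.toFinite _) ?_
  intro a ha b hb hab
  have key : ∀ g, g ∈ Subgroup.centralizer {u} → g ∉ Subgroup.zpowers u →
      -g ∈ Subgroup.zpowers u := by
    intro g hg hg'
    obtain ⟨k, rfl | rfl⟩ := hu.exists_zpow g (mem_centralizer_singleton.1 hg)
    · exact absurd (Subgroup.zpow_mem_zpowers u k) hg'
    · rw [neg_neg]
      exact Subgroup.zpow_mem_zpowers u k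
  by_cases hau : a ∈ Subgroup.zpowers u
  · exact mul_mem (inv_mem hau) (hab.mp hau)
  · have hbu : b ∉ Subgroup.zpowers u := fun h => hau (hab.mpr h)
    have := mul_mem (inv_mem (key a ha hau)) (key b hb hbu)
    rwa [inv_neg, neg_mul_neg] at this

/-- Conjugation by g and by its inverse send u to ±u ^ i and ±u ^ j; infinite order modulo ±1 forces
i j = 1. -/
theorem IsRoot.conj_eq {u g : SL(2, ℤ)} (hu : IsRoot u)
    (hg : g ∈ Subgroup.normalizer (Subgroup.centralizer {u} : Subgroup SL(2, ℤ))) :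
    g * u * g⁻¹ ∈ ({u, -u, u⁻¹, -u⁻¹} : Set SL(2, ℤ)) := by
  have hself : u ∈ Subgroup.centralizer {u} := mem_centralizer_singleton.2 (Commute.refl u)
  have hgu := (Subgroup.mem_normalizer_iff.1 hg u).1 hself
  have hgu' := (Subgroup.mem_normalizer_iff''.1 hg u).1 hself
  obtain ⟨i, hi⟩ := hu.exists_zpow _ (mem_centralizer_singleton.1 hgu)
  obtain ⟨j, hj⟩ := hu.exists_zpow _ (mem_centralizer_singleton.1 hgu')
  have hpow : (g * u * g⁻¹) ^ j = g * u ^ j * g⁻¹ := conj_zpow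
  have e1 : g * u ^ j * g⁻¹ = u ∨ g * u ^ j * g⁻¹ = -u := by
    have hcancel : g * (g⁻¹ * u * g) * g⁻¹ = u := by group
    rcases hj with hj | hj
    · exact Or.inl (by rw [← hj, hcancel])
    · right
      rw [← neg_eq_iff_eq_neg.2 hj, mul_neg, neg_mul, hcancel]
  have e2 : (g * u * g⁻¹) ^ j = u ^ (i * j) ∨ (g * u * g⁻¹) ^ j = -u ^ (i * j) := by
    rcases hi with hi | hi
    · exact Or.inl (by rw [hi, zpow_mul])
    · rw [hi, zpow_mul]
      rcases Int.even_or_odd j with hev | hod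
      · exact Or.inl (hev.neg_zpow _)
      · exact Or.inr (hod.neg_zpow _)
  have e3 : u ^ (i * j) = u ∨ u ^ (i * j) = -u := by
    rw [hpow] at e2
    rcases e1 with e1 | e1 <;> rcases e2 with e2 | e2 <;> rw [e1] at e2
    · exact Or.inl e2.symm
    · exact Or.inr (neg_eq_iff_eq_neg.1 e2.symm)
    · exact Or.inr e2.symm
    · exact Or.inl (neg_inj.1 e2).symm
  have e4 : i * j - 1 = 0 := by
    refine hu.eq_zero _ ?_
    rw [zpow_sub, zpow_one]
    rcases e3 with e3 | e3 <;> rw [e3]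
    · exact Or.inl (mul_inv_cancel u)
    · exact Or.inr (by rw [neg_mul, mul_inv_cancel])
  simp only [Set.mem_insert_iff, Set.mem_singleton_iff]
  rcases Int.eq_one_or_neg_one_of_mul_eq_one (sub_eq_zero.1 e4) with rfl | rfl
  · rw [zpow_one] at hi
    exact hi.elim Or.inl fun h => Or.inr (Or.inl h)
  · rw [zpow_neg_one] at hi
    exact Or.inr (Or.inr hi)

theorem IsRoot.relIndex_centralizer {u : SL(2, ℤ)} (hu : IsRoot u) {H : Subgroup SL(2, ℤ)}
    (hH : H ≤ Subgroup.normalizer (Subgroup.centralizer {u} : Subgroup SL(2, ℤ))) :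
    (Subgroup.centralizer {u}).relIndex H ≠ 0 := by
  refine relIndex_ne_zero_of_separating (fun g => g * u * g⁻¹)
    ((Set.toFinite ({u, -u, u⁻¹, -u⁻¹} : Set SL(2, ℤ))).subset ?_) ?_
  · rintro _ ⟨g, hg, rfl⟩
    exact hu.conj_eq (hH hg)
  · intro a _ b _ hab
    rw [mem_centralizer_singleton, commute_iff_eq]
    have hab' : a * u * a⁻¹ = b * u * b⁻¹ := hab
    calc a⁻¹ * b * u = a⁻¹ * (b * u * b⁻¹) * b := by group
      _ = u * (a⁻¹ * b) := by rw [← hab']; group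

theorem isVirtuallyCyclic_of_le_normalizer {u : SL(2, ℤ)} (hu : IsRoot u)
    {H : Subgroup SL(2, ℤ)}
    (hH : H ≤ Subgroup.normalizer (Subgroup.centralizer {u} : Subgroup SL(2, ℤ))) :
    IsVirtuallyCyclic H := by
  refine ⟨(Subgroup.zpowers u).subgroupOf H, ?_, Subgroup.finiteIndex_iff.2
    (Subgroup.relIndex_ne_zero_trans hu.relIndex_zpowers (hu.relIndex_centralizer hH))⟩
  refine isCyclic_of_injective
    (H.subtype.subgroupComap (Subgroup.zpowers u)) fun x y hxy => ?_
  have h := congrArg Subtype.val hxy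
  exact Subtype.ext (Subtype.ext h)

/-- Noncentral commuting elements have the same centralizer. So u, r and z⁻¹ r z share theirs, and
conjugation by z preserves it. -/
theorem mem_normalizer_of_conj_mem {u r z : SL(2, ℤ)} (hu : IsRoot u) (hr : Commute r u)
    (hz : Commute (z⁻¹ * r * z) u) (h1 : r ≠ 1) (h2 : r ≠ -1) :
    z ∈ Subgroup.normalizer (Subgroup.centralizer {u} : Subgroup SL(2, ℤ)) := by
  have h3 : z⁻¹ * r * z ≠ 1 := by
    intro h
    apply h1
    rw [show r = z * (z⁻¹ * r * z) * z⁻¹ by group, h]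
    group
  have h4 : z⁻¹ * r * z ≠ -1 := by
    intro h
    apply h2
    rw [show r = z * (z⁻¹ * r * z) * z⁻¹ by group, h]
    simp
  rw [Subgroup.mem_normalizer_iff]
  intro g
  rw [mem_centralizer_singleton, mem_centralizer_singleton]
  have e1 : Commute g u ↔ Commute g (z⁻¹ * r * z) :=
    ⟨fun h => commute_of_commute hu.ne_one hu.ne_neg_one h hz,
      fun h => commute_of_commute h3 h4 h hz.symm⟩
  have e2 : Commute (z * g * z⁻¹) u ↔ Commute (z * g * z⁻¹) r :=
    ⟨fun h => commute_of_commute hu.ne_one hu.ne_neg_one h hr,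
      fun h => commute_of_commute h1 h2 h hr.symm⟩
  rw [e1, e2]
  constructor
  · intro h
    have h' : g * (z⁻¹ * r * z) = (z⁻¹ * r * z) * g := h
    rw [commute_iff_eq]
    calc z * g * z⁻¹ * r = z * (g * (z⁻¹ * r * z)) * z⁻¹ := by group
      _ = _ := by rw [h']; group
  · intro h
    have h' : (z * g * z⁻¹) * r = r * (z * g * z⁻¹) := h
    rw [commute_iff_eq]
    calc g * (z⁻¹ * r * z) = z⁻¹ * ((z * g * z⁻¹) * r) * z := by group
      _ = _ := by rw [h']; group

/-! ### Growth of a set inside a coset of a centralizer. -/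

/-- A coincidence x t x' = y t y' puts an element r and its conjugate by x₀ t in the centralizer of
u. As x₀ t is not in the normalizer, r = ±1, so only a common sign change remains. -/
theorem card_mul_card_le_two_mul_image {u t x₀ : SL(2, ℤ)} (hu : IsRoot u)
    {X : Finset SL(2, ℤ)} (hX : ∀ x ∈ X, Commute (x * x₀⁻¹) u)
    (ht : x₀ * t ∉ Subgroup.normalizer (Subgroup.centralizer {u} : Subgroup SL(2, ℤ))) :
    X.card * X.card ≤ 2 * ((X ×ˢ X).image fun z => z.1 * t * z.2).card := by
  rw [← Finset.card_product]
  refine Finset.card_le_mul_card_image _ 2 fun w hw => ?_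
  obtain ⟨⟨y, y'⟩, hy, rfl⟩ := Finset.mem_image.1 hw
  obtain ⟨hy1, hy2⟩ := Finset.mem_product.1 hy
  refine (Finset.card_le_card (t := {(y, y'), (-y, -y')}) ?_).trans Finset.card_le_two
  rintro ⟨x, x'⟩ hx
  simp only [Finset.mem_filter, Finset.mem_product] at hx
  obtain ⟨⟨hx1, hx2⟩, he⟩ := hx
  have hr : Commute ((y * x₀⁻¹)⁻¹ * (x * x₀⁻¹)) u := ((hX y hy1).inv_left).mul_left (hX x hx1)
  have hz : Commute ((y' * x₀⁻¹) * (x' * x₀⁻¹)⁻¹) u :=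
    (hX y' hy2).mul_left ((hX x' hx2).inv_left)
  have hconj : (x₀ * t)⁻¹ * ((y * x₀⁻¹)⁻¹ * (x * x₀⁻¹)) * (x₀ * t) =
      (y' * x₀⁻¹) * (x' * x₀⁻¹)⁻¹ := by
    have hx' : x = y * t * y' * x'⁻¹ * t⁻¹ := by rw [← he]; group
    rw [hx']
    group
  rw [← hconj] at hz
  have hpm : (y * x₀⁻¹)⁻¹ * (x * x₀⁻¹) = 1 ∨ (y * x₀⁻¹)⁻¹ * (x * x₀⁻¹) = -1 := by
    by_contra hcon
    push Not at hcon
    exact ht (mem_normalizer_of_conj_mem hu hr hz hcon.1 hcon.2)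
  have hxy : x = (y * x₀⁻¹) * ((y * x₀⁻¹)⁻¹ * (x * x₀⁻¹)) * x₀ := by group
  simp only [Finset.mem_insert, Finset.mem_singleton, Prod.mk.injEq]
  rcases hpm with h | h <;> rw [h] at hxy
  · left
    have hxy : x = y := by rw [hxy]; group
    subst hxy
    exact ⟨rfl, mul_left_cancel he⟩
  · right
    have hxy : x = -y := by rw [hxy]; simp
    subst hxy
    refine ⟨rfl, mul_left_cancel (a := -y * t) (he.trans ?_)⟩
    simp

theorem sq_card_le_two_mul_card_pow {u x₀ : SL(2, ℤ)} (hu : IsRoot u)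
    {A X : Finset SL(2, ℤ)} (hXA : X ⊆ A) (hx₀ : x₀ ∈ X) (hX : ∀ x ∈ X, Commute (x * x₀⁻¹) u)
    (hA : ¬ IsVirtuallyCyclic (Subgroup.closure (A : Set SL(2, ℤ)))) :
    X.card * X.card ≤ 2 * (A ^ 3).card := by
  -- If x₀ normalizes, the middle factor is an element of A that does not; otherwise t = 1 works and
  -- the products already lie in A².
  by_cases h0 : x₀ ∈ Subgroup.normalizer (Subgroup.centralizer {u} : Subgroup SL(2, ℤ))
  · obtain ⟨t, htA, ht⟩ : ∃ t ∈ A,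
        t ∉ Subgroup.normalizer (Subgroup.centralizer {u} : Subgroup SL(2, ℤ)) := by
      by_contra hcon
      push Not at hcon
      exact hA (isVirtuallyCyclic_of_le_normalizer hu ((Subgroup.closure_le _).2 hcon))
    refine (card_mul_card_le_two_mul_image hu (t := t) hX
      fun h => ht ((Subgroup.mul_mem_cancel_left _ h0).1 h)).trans ?_
    refine Nat.mul_le_mul_left 2 (Finset.card_le_card ?_)
    rintro _ hw
    obtain ⟨⟨x, y⟩, hxy, rfl⟩ := Finset.mem_image.1 hw
    obtain ⟨hx, hy⟩ := Finset.mem_product.1 hxy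
    rw [pow_succ, pow_two]
    exact Finset.mul_mem_mul (Finset.mul_mem_mul (hXA hx) htA) (hXA hy)
  · refine (card_mul_card_le_two_mul_image hu (t := 1) hX (by rwa [mul_one])).trans ?_
    have hne : A.Nonempty := ⟨x₀, hXA hx₀⟩
    refine Nat.mul_le_mul_left 2 ((Finset.card_le_card (t := A ^ 2) ?_).trans
      (hne.card_pow_mono (by norm_num)))
    rintro _ hw
    obtain ⟨⟨x, y⟩, hxy, rfl⟩ := Finset.mem_image.1 hw
    obtain ⟨hx, hy⟩ := Finset.mem_product.1 hxy
    rw [pow_two, mul_one]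
    exact Finset.mul_mem_mul (hXA hx) (hXA hy)

/-! ### Growth from two opposite families of words. -/

/-- Growth for a set containing many translated words `g * w * h` and many, longer, words
translated the opposite way. -/
theorem sq_card_le_of_words {A : Finset SL(2, ℤ)} {P X : Finset (FreeMonoid Bool)}
    {g h ζ : SL(2, ℤ)} (hζ : ∀ z, ζ * z = z * ζ)
    (hA : ¬ IsVirtuallyCyclic (Subgroup.closure (A : Set SL(2, ℤ))))
    (hP : ∀ w ∈ P, g * mat w * h ∈ A) (hX : ∀ w ∈ X, ζ * (h⁻¹ * mat w * g⁻¹) ∈ A)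
    (hl : ∀ a ∈ P, ∀ x ∈ X, a.length ≤ x.length)
    (hPc : A.card ≤ 72 * P.card) (hXc : A.card ≤ 72 * X.card) :
    A.card ^ 2 ≤ 31104 * (A ^ 3).card := by
  classical
  rcases X.eq_empty_or_nonempty with rfl | ⟨x₀, hx₀⟩
  · have : A.card = 0 := by simpa using hXc
    simp [this]
  by_cases hbig : ∃ x ∈ X, P.card * P.card ≤ 6 * (sandwich P x P).card
  · obtain ⟨x, hx, hb⟩ := hbig
    have hle : (sandwich P x P).card ≤ (A ^ 3).card := by
      refine Finset.card_le_card_of_injOn (fun w => ζ * (g * mat w * h)) ?_ ?_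
      · intro w hw
        obtain ⟨⟨a, b⟩, hab, rfl⟩ := Finset.mem_image.1 (Finset.mem_coe.1 hw)
        obtain ⟨ha, hb⟩ := Finset.mem_product.1 hab
        have e : ζ * (g * mat (a * x * b) * h) =
            (g * mat a * h) * (ζ * (h⁻¹ * mat x * g⁻¹)) * (g * mat b * h) := by
          rw [← mul_assoc (g * mat a * h), ← hζ, map_mul, map_mul]
          group
        show ζ * (g * mat (a * x * b) * h) ∈ _
        rw [e, Finset.mem_coe, pow_succ, pow_two]
        exact Finset.mul_mem_mul (Finset.mul_mem_mul (hP a ha) (hX x hx)) (hP b hb)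
      · intro v _ w _ hvw
        exact mat_injective (by simpa using hvw)
    nlinarith [Nat.mul_le_mul hPc hPc]
  · push Not at hbig
    obtain ⟨u, hu1, hu⟩ := exists_common_period hx₀ hl hbig
    obtain ⟨p, hpu, hp⟩ := exists_isRoot_mat hu1
    have hcomm : ∀ y ∈ X, Commute (mat y * (mat x₀)⁻¹) (mat p) := by
      intro y hy
      obtain ⟨k, hk, c, h1, h2⟩ := hu y hy
      have hne := pow_ne_one hu1 hk
      -- Sharing the phase c means that x₀ and y conjugate u ^ k to the same element, so y x₀⁻¹
      -- commutes with u ^ k.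
      refine commute_of_commute (u := mat (u ^ k)) (fun h => hne (mat_eq_one h))
        (fun h => mat_ne_neg (u ^ k) 1 (by rw [h, map_one])) ?_
        ((hpu.pow_right k).map mat)
      have h1' : mat (u ^ k) * mat x₀ = mat x₀ * mat c := by rw [← map_mul, h1, map_mul]
      have h2' : mat (u ^ k) * mat y = mat y * mat c := by rw [← map_mul, h2, map_mul]
      rw [commute_iff_eq, ← mul_assoc, h2']
      have hc : mat c = (mat x₀)⁻¹ * (mat (u ^ k) * mat x₀) := by rw [h1']; group
      rw [hc]
      group
    have hinj : Function.Injective fun w => ζ * (h⁻¹ * mat w * g⁻¹) := fun v w hvw =>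
      mat_injective (by simpa using hvw)
    have hcard := sq_card_le_two_mul_card_pow (hp.conj h) (A := A)
      (X := X.image fun w => ζ * (h⁻¹ * mat w * g⁻¹))
      (x₀ := ζ * (h⁻¹ * mat x₀ * g⁻¹))
      (Finset.image_subset_iff.2 hX) (Finset.mem_image_of_mem _ hx₀) (by
        intro z hz
        obtain ⟨y, hy, rfl⟩ := Finset.mem_image.1 hz
        have e : ζ * (h⁻¹ * mat y * g⁻¹) * (ζ * (h⁻¹ * mat x₀ * g⁻¹))⁻¹ =
            h⁻¹ * (mat y * (mat x₀)⁻¹) * h := by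
          rw [hζ, mul_inv_rev]
          rw [show (h⁻¹ * mat x₀ * g⁻¹)⁻¹ * ζ⁻¹ = ζ⁻¹ * (h⁻¹ * mat x₀ * g⁻¹)⁻¹ by
            rw [← mul_inv_rev, hζ, mul_inv_rev]]
          group
        rw [e]
        have h' : (mat y * (mat x₀)⁻¹) * mat p = mat p * (mat y * (mat x₀)⁻¹) := hcomm y hy
        rw [commute_iff_eq]
        calc _ = h⁻¹ * ((mat y * (mat x₀)⁻¹) * mat p) * h := by group
          _ = _ := by rw [h']; group) hA
    rw [Finset.card_image_of_injective X hinj] at hcard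
    nlinarith [Nat.mul_le_mul hXc hXc]

/-! ### Locating two large opposite families in A. -/

theorem IsWord.neg {g : SL(2, ℤ)} (h : IsWord g) : IsWord (-g) := by
  obtain ⟨w, rfl | rfl⟩ := h
  · exact ⟨w, Or.inr rfl⟩
  · exact ⟨w, Or.inl (neg_neg _)⟩

open Classical in
/-- The elements of `A` of the form `± g * w * h` for a word `w`. -/
noncomputable def near (A : Finset SL(2, ℤ)) (g h : SL(2, ℤ)) : Finset SL(2, ℤ) :=
  A.filter fun a => IsWord (g⁻¹ * a * h⁻¹)

theorem mem_near {A : Finset SL(2, ℤ)} {g h a : SL(2, ℤ)} :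
    a ∈ near A g h ↔ a ∈ A ∧ IsWord (g⁻¹ * a * h⁻¹) := by
  classical
  exact Finset.mem_filter

theorem neg_one_mul_comm (z : SL(2, ℤ)) : (-1) * z = z * (-1) := by simp

theorem exists_words_of_near (A : Finset SL(2, ℤ)) (g h : SL(2, ℤ)) :
    ∃ (P : Finset (FreeMonoid Bool)) (ζ : SL(2, ℤ)), (∀ z, ζ * z = z * ζ) ∧
      (near A g h).card ≤ 2 * P.card ∧ ∀ w ∈ P, ζ * (g * mat w * h) ∈ A := by
  classical
  have hinj : ∀ ζ : SL(2, ℤ), Function.Injective fun w => ζ * (g * mat w * h) := fun ζ v w hvw =>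
    mat_injective (by simpa using hvw)
  let Q : SL(2, ℤ) → Finset (FreeMonoid Bool) := fun ζ =>
    A.preimage (fun w => ζ * (g * mat w * h)) (hinj ζ).injOn
  have hmem : ∀ ζ, ∀ w ∈ Q ζ, ζ * (g * mat w * h) ∈ A := fun ζ w hw =>
    (Finset.mem_preimage (f := fun w => ζ * (g * mat w * h)) (hf := (hinj ζ).injOn)).1 hw
  have hcard : (near A g h).card ≤ (Q 1).card + (Q (-1)).card := by
    have hsub : near A g h ⊆ ((Q 1).image fun w => 1 * (g * mat w * h)) ∪
        ((Q (-1)).image fun w => (-1) * (g * mat w * h)) := by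
      intro a ha
      obtain ⟨haA, w, hw⟩ := mem_near.1 ha
      have hag : a = g * (g⁻¹ * a * h⁻¹) * h := by group
      rcases hw with hw | hw <;> rw [hw] at hag
      · refine Finset.mem_union_left _ (Finset.mem_image.2 ⟨w, Finset.mem_preimage.2 ?_, ?_⟩)
        · rwa [one_mul, ← hag]
        · rw [one_mul, ← hag]
      · have hag' : a = (-1) * (g * mat w * h) := by rw [hag]; simp
        exact Finset.mem_union_right _ (Finset.mem_image.2
          ⟨w, Finset.mem_preimage.2 (hag' ▸ haA), hag'.symm⟩)
    refine (Finset.card_le_card hsub).trans ((Finset.card_union_le _ _).trans ?_)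
    exact Nat.add_le_add Finset.card_image_le Finset.card_image_le
  rcases le_total (Q 1).card (Q (-1)).card with hle | hle
  · exact ⟨Q (-1), -1, neg_one_mul_comm, by omega, hmem _⟩
  · exact ⟨Q 1, 1, fun z => by rw [one_mul, mul_one], by omega, hmem _⟩

theorem exists_median {α : Type*} (P : Finset α) (f : α → ℕ) :
    ∃ t, P.card ≤ 2 * (P.filter fun a => f a ≤ t).card ∧
      P.card ≤ 2 * (P.filter fun a => t ≤ f a).card := by
  classical
  have hex : ∃ t, P.card ≤ 2 * (P.filter fun a => f a ≤ t).card := by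
    refine ⟨P.sup f, ?_⟩
    rw [Finset.filter_true_of_mem fun a ha => Finset.le_sup ha]
    omega
  refine ⟨Nat.find hex, Nat.find_spec hex, ?_⟩
  rcases Nat.eq_zero_or_pos (Nat.find hex) with h0 | hpos
  · rw [h0, Finset.filter_true_of_mem fun a _ => Nat.zero_le _]
    omega
  · have hlt := Nat.find_min hex (Nat.sub_lt hpos one_pos)
    have hsplit := Finset.card_filter_add_card_filter_not (s := P)
      (fun a => f a ≤ Nat.find hex - 1)
    have hcongr : (P.filter fun a => ¬ f a ≤ Nat.find hex - 1) =
        P.filter fun a => Nat.find hex ≤ f a :=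
      Finset.filter_congr fun a _ => by omega
    rw [hcongr] at hsplit
    omega

/-- The proportion 1/18 drops to 1/36 on fixing the sign and to 1/72 on cutting at the median. The
family with the smaller median contributes its short half, the other its long half. -/
theorem sq_card_le_of_near {A : Finset SL(2, ℤ)}
    (hA : ¬ IsVirtuallyCyclic (Subgroup.closure (A : Set SL(2, ℤ)))) {g h : SL(2, ℤ)}
    (h1 : A.card ≤ 18 * (near A g h).card) (h2 : A.card ≤ 18 * (near A h⁻¹ g⁻¹).card) :
    A.card ^ 2 ≤ 31104 * (A ^ 3).card := by
  obtain ⟨P, ζ, hζ, hPc, hP⟩ := exists_words_of_near A g h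
  obtain ⟨X, ξ, hξ, hXc, hX⟩ := exists_words_of_near A h⁻¹ g⁻¹
  have key : ∀ (g h ζ ξ : SL(2, ℤ)) (P X : Finset (FreeMonoid Bool)) (s t : ℕ),
      (∀ z, ζ * z = z * ζ) → (∀ z, ξ * z = z * ξ) →
      (∀ w ∈ P, ζ * (g * mat w * h) ∈ A) → (∀ w ∈ X, ξ * (h⁻¹ * mat w * g⁻¹) ∈ A) →
      A.card ≤ 72 * (P.filter fun a => a.length ≤ s).card →
      A.card ≤ 72 * (X.filter fun a => t ≤ a.length).card → s ≤ t →
      A.card ^ 2 ≤ 31104 * (A ^ 3).card := by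
    intro g h ζ ξ P X s t hζ hξ hP hX hPc hXc hst
    refine sq_card_le_of_words (g := ζ * g) (h := h) (ζ := ξ * ζ)
      (P := P.filter fun a => a.length ≤ s) (X := X.filter fun a => t ≤ a.length)
      ?_ hA ?_ ?_ ?_ hPc hXc
    · intro z
      rw [mul_assoc, hζ, ← mul_assoc, hξ, mul_assoc]
    · intro w hw
      have := hP w (Finset.mem_filter.1 hw).1
      rwa [← mul_assoc, ← mul_assoc] at this
    · intro w hw
      have := hX w (Finset.mem_filter.1 hw).1
      have e : ξ * ζ * (h⁻¹ * mat w * (ζ * g)⁻¹) = ξ * (h⁻¹ * mat w * g⁻¹) := by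
        rw [mul_inv_rev, mul_assoc, hζ]
        group
      rwa [e]
    · intro a ha x hx
      exact ((Finset.mem_filter.1 ha).2.trans hst).trans (Finset.mem_filter.1 hx).2
  obtain ⟨s, hs1, hs2⟩ := exists_median P FreeMonoid.length
  obtain ⟨t, ht1, ht2⟩ := exists_median X FreeMonoid.length
  rcases le_total s t with hst | hst
  · exact key g h ζ ξ P X s t hζ hξ hP hX (by omega) (by omega) hst
  · exact key h⁻¹ g⁻¹ ξ ζ X P t s hξ hζ hX (by simpa using hP) (by omega) (by omega) hst

theorem letter_mul_S_mul_letter (l : Bool) : letter l * S * letter (!l) = S := by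
  cases l <;> decide

theorem letter_mul_S_mul_self (l : Bool) :
    letter l * S * letter l = letter (!l) ∨
    letter l * S * letter l = -letter (!l) := by
  cases l <;> decide

theorem word_cases (w : FreeMonoid Bool) :
    w = 1 ∨ (∃ l, w = of l) ∨ ∃ l v l', w = of l * v * of l' := by
  have hrev : ∀ v : FreeMonoid Bool, v = 1 ∨ ∃ u l, v = u * of l := by
    intro v
    rcases List.eq_nil_or_concat (toList v) with h | ⟨u, l, h⟩
    · exact Or.inl h
    · exact Or.inr ⟨ofList u, l, by rw [List.concat_eq_append] at h; exact h⟩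
  induction w using FreeMonoid.inductionOn' with
  | one => exact Or.inl rfl
  | of_mul l v _ =>
    rcases hrev v with rfl | ⟨u, l', rfl⟩
    · exact Or.inr (Or.inl ⟨l, mul_one _⟩)
    · exact Or.inr (Or.inr ⟨l, u, l', (mul_assoc _ _ _).symm⟩)

/-- The at most six elements taking an edge to one adjacent to it and facing it. -/
def facing (e : SL(2, ℤ)) : Finset SL(2, ℤ) :=
  {e * S * e⁻¹, -(e * S * e⁻¹), e * letter true * S * e⁻¹, -(e * letter true * S * e⁻¹),
    e * letter false * S * e⁻¹, -(e * letter false * S * e⁻¹)}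

/-- Write the word as l v l'. If l' ≠ l, then l' S l = S and the form persists one edge further; if
l' = l, then l S l is a letter up to sign. Words of length at most one give the six exceptions. -/
theorem near_subset (A : Finset SL(2, ℤ)) (e : SL(2, ℤ)) :
    near A e (S * e⁻¹) ⊆ facing e ∪ Finset.univ.biUnion fun l : Bool =>
      near A (e * letter l) (S * (e * letter l)⁻¹) ∪ near A (e * letter l) (e * letter l)⁻¹ := by
  intro a ha
  obtain ⟨haA, w, hw⟩ := mem_near.1 ha
  have hea : a = e * (e⁻¹ * a * (S * e⁻¹)⁻¹) * S * e⁻¹ := by group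
  have ha' : a = e * mat w * S * e⁻¹ ∨ a = -(e * mat w * S * e⁻¹) := by
    rcases hw with hw | hw <;> rw [hw] at hea
    · exact Or.inl hea
    · exact Or.inr (by rw [hea]; simp)
  rw [Finset.mem_union, Finset.mem_biUnion]
  rcases word_cases w with rfl | ⟨l, rfl⟩ | ⟨l, v, l', rfl⟩
  · left
    rw [map_one, mul_one] at ha'
    rcases ha' with rfl | rfl <;> simp [facing]
  · left
    have hl : mat (of l) = letter l := by simp [mat]
    rw [hl] at ha'
    rcases ha' with rfl | rfl <;> cases l <;> simp [facing]
  · right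
    refine ⟨l, Finset.mem_univ l, Finset.mem_union.2 ?_⟩
    have hl' : mat (of l') = letter l' := by simp [mat]
    have hmat : mat (of l * v * of l') = letter l * mat v * letter l' := by
      rw [mul_assoc, mat_of_mul, map_mul, hl', mul_assoc]
    rw [hmat] at ha'
    have hback : (e * letter l)⁻¹ * (e * (letter l * mat v * letter l') * S * e⁻¹) *
        (e * letter l) = mat v * (letter l' * S * letter l) := by group
    rcases Bool.eq_or_eq_not l' l with rfl | rfl
    · right
      refine mem_near.2 ⟨haA, ?_⟩
      have hword : IsWord (mat v * letter (!l')) := ⟨v * of (!l'), Or.inl (by simp [mat])⟩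
      have hword' : IsWord (mat v * (letter l' * S * letter l')) := by
        rcases letter_mul_S_mul_self l' with h | h <;> rw [h]
        · exact hword
        · rw [mul_neg]
          exact hword.neg
      rw [inv_inv]
      rcases ha' with rfl | rfl
      · rwa [hback]
      · rw [mul_neg, neg_mul, hback]
        exact hword'.neg
    · left
      have hS := letter_mul_S_mul_letter (!l)
      rw [Bool.not_not] at hS
      rw [hS] at hback
      refine mem_near.2 ⟨haA, ?_⟩
      rw [mul_inv_rev S, inv_inv, ← mul_assoc]
      rcases ha' with rfl | rfl
      · rw [hback]
        exact ⟨v, Or.inl (by group)⟩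
      · rw [mul_neg, neg_mul, hback]
        exact ⟨v, Or.inr (by rw [neg_mul]; group)⟩

/-- If no pair worked, more than 15/18 of A would face a single edge, and this majority would follow
an infinite path of edges. A finite set cannot do so, since matrix entries grow with depth. -/
theorem exists_near {A : Finset SL(2, ℤ)} (hn : 10 ≤ A.card) :
    ∃ g h, A.card ≤ 18 * (near A g h).card ∧ A.card ≤ 18 * (near A h⁻¹ g⁻¹).card := by
  classical
  by_contra! hcon
  -- The pair (e, e⁻¹) is its own opposite.
  have h1 : ∀ e, 18 * (near A e e⁻¹).card < A.card := by
    intro e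
    by_contra! h
    have := hcon e e⁻¹ h
    rw [inv_inv] at this
    omega
  have cover : ∀ e, A.card ≤ (near A e e⁻¹).card + (near A (e * S) (e * S)⁻¹).card +
      (near A e (S * e⁻¹)).card + (near A (S * e⁻¹)⁻¹ e⁻¹).card := by
    intro e
    have hsub : A ⊆ near A e e⁻¹ ∪ near A (e * S) (e * S)⁻¹ ∪ near A e (S * e⁻¹) ∪
        near A (S * e⁻¹)⁻¹ e⁻¹ := by
      intro a ha
      simp only [Finset.mem_union, mem_near]
      rcases isWord_cases (e⁻¹ * a * e) with h | h | h | h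
      · exact Or.inl (Or.inl (Or.inl ⟨ha, by rwa [inv_inv]⟩))
      · refine Or.inl (Or.inl (Or.inr ⟨ha, ?_⟩))
        convert h using 1
        group
      · refine Or.inl (Or.inr ⟨ha, ?_⟩)
        convert h using 1
        group
      · refine Or.inr ⟨ha, ?_⟩
        convert h.neg using 1
        rw [S_inv, inv_inv, inv_inv]
        simp [mul_assoc]
    refine (Finset.card_le_card hsub).trans ((Finset.card_union_le _ _).trans ?_)
    refine Nat.add_le_add_right ((Finset.card_union_le _ _).trans ?_) _
    exact Nat.add_le_add_right (Finset.card_union_le _ _) _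
  have large : ∀ e, 18 * (near A (S * e⁻¹)⁻¹ e⁻¹).card < A.card →
      15 * A.card < 18 * (near A e (S * e⁻¹)).card := by
    intro e he
    have := cover e
    have := h1 e
    have := h1 (e * S)
    omega
  have step : ∀ e, 18 * (near A (S * e⁻¹)⁻¹ e⁻¹).card < A.card →
      ∃ l, 18 * (near A (S * (e * letter l)⁻¹)⁻¹ (e * letter l)⁻¹).card < A.card := by
    intro e he
    by_contra! hall
    have hsmall : ∀ l, 18 * (near A (e * letter l) (S * (e * letter l)⁻¹)).card < A.card := by
      intro l
      by_contra! h
      exact absurd (hcon _ _ h) (not_lt.2 (hall l))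
    have hsub := Finset.card_le_card (near_subset A e)
    have hf : (facing e).card ≤ 6 := Finset.card_le_six
    have hu := Finset.card_union_le (facing e) (Finset.univ.biUnion fun l : Bool =>
      near A (e * letter l) (S * (e * letter l)⁻¹) ∪ near A (e * letter l) (e * letter l)⁻¹)
    have hb : (Finset.univ.biUnion fun l : Bool =>
        near A (e * letter l) (S * (e * letter l)⁻¹) ∪
          near A (e * letter l) (e * letter l)⁻¹).card ≤ _ := Finset.card_biUnion_le
    rw [Fintype.sum_bool] at hb
    have c1 := Finset.card_union_le (near A (e * letter true) (S * (e * letter true)⁻¹))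
      (near A (e * letter true) (e * letter true)⁻¹)
    have c2 := Finset.card_union_le (near A (e * letter false) (S * (e * letter false)⁻¹))
      (near A (e * letter false) (e * letter false)⁻¹)
    have := large e he
    have := hsmall true
    have := hsmall false
    have := h1 (e * letter true)
    have := h1 (e * letter false)
    -- If both next edges failed, then 15|A| < 18 · 6 + 4|A|, which is false for |A| ≥ 10.
    omega
  -- The edges 1 and S are the two orientations of the base edge and exchange the two facing
  -- families, so one of them qualifies.
  obtain ⟨e₀, he₀⟩ : ∃ e, 18 * (near A (S * e⁻¹)⁻¹ e⁻¹).card < A.card := by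
    by_contra! hall
    have ha := hall 1
    have hb := hall S
    refine absurd (hcon 1 (S * 1⁻¹) ?_) (not_lt.2 (by simpa using ha))
    refine hb.trans (Nat.mul_le_mul_left 18 (Finset.card_le_card fun a ha => ?_))
    obtain ⟨haA, hw⟩ := mem_near.1 ha
    refine mem_near.2 ⟨haA, ?_⟩
    convert hw.neg using 1
    simp only [inv_one, mul_one, one_mul, inv_inv, mul_inv_cancel]
    rw [S_inv, mul_neg]
  have descent : ∀ k : ℕ, ∃ w : FreeMonoid Bool, w.length = k ∧
      18 * (near A (S * (e₀ * mat w)⁻¹)⁻¹ (e₀ * mat w)⁻¹).card < A.card := by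
    intro k
    induction k with
    | zero => exact ⟨1, rfl, by simpa using he₀⟩
    | succ k ih =>
      obtain ⟨w, hw, hk⟩ := ih
      obtain ⟨l, hl⟩ := step _ hk
      refine ⟨w * of l, by rw [length_mul, hw, length_of], ?_⟩
      have : mat (w * of l) = mat w * letter l := by simp [mat]
      rwa [this, ← mul_assoc]
  set size : SL(2, ℤ) → ℕ := fun a =>
    ((e₀⁻¹ * a * e₀ * S⁻¹) 0 0).natAbs + ((e₀⁻¹ * a * e₀ * S⁻¹) 0 1).natAbs +
      ((e₀⁻¹ * a * e₀ * S⁻¹) 1 0).natAbs + ((e₀⁻¹ * a * e₀ * S⁻¹) 1 1).natAbs with hsize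
  -- This depth is at least the size of each element of A, while an element found at this depth has
  -- size at least the depth plus 2.
  obtain ⟨w, hwl, hw⟩ := descent (∑ a ∈ A, size a)
  have hpos : 0 < (near A (e₀ * mat w) (S * (e₀ * mat w)⁻¹)).card := by
    have := large _ hw
    omega
  obtain ⟨a, ha⟩ := Finset.card_pos.1 hpos
  obtain ⟨haA, v, hv⟩ := mem_near.1 ha
  obtain ⟨w', hw', -⟩ := exists_flip w
  have hle : size a ≤ ∑ a ∈ A, size a := Finset.single_le_sum (fun _ _ => Nat.zero_le _) haA
  have hform : e₀⁻¹ * a * e₀ * S⁻¹ = mat (w * v * w') ∨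
      e₀⁻¹ * a * e₀ * S⁻¹ = -mat (w * v * w') := by
    have e : e₀⁻¹ * a * e₀ * S⁻¹ = mat w *
        ((e₀ * mat w)⁻¹ * a * (S * (e₀ * mat w)⁻¹)⁻¹) * mat w' := by
      rw [← hw']
      group
    rcases hv with hv | hv <;> rw [hv] at e
    · exact Or.inl (by rw [e, map_mul, map_mul])
    · exact Or.inr (by rw [e, map_mul, map_mul]; simp)
  have hlen := length_le_entries (w * v * w')
  simp only [length_mul, hwl] at hlen
  obtain ⟨n1, n2, n3, n4⟩ := mat_nonneg (w * v * w')
  rcases hform with hform | hform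
  · simp only [hsize, hform] at hle hlen
    omega
  · simp only [hsize, hform, neg_entries, Int.natAbs_neg] at hle hlen
    omega

theorem sq_card_le (A : Finset SL(2, ℤ))
    (hA : ¬ IsVirtuallyCyclic (Subgroup.closure (A : Set SL(2, ℤ)))) :
    A.card ^ 2 ≤ 31104 * (A ^ 3).card := by
  rcases le_or_gt 10 A.card with hn | hn
  · obtain ⟨g, h, h1, h2⟩ := exists_near hn
    exact sq_card_le_of_near hA h1 h2
  · rcases A.eq_empty_or_nonempty with rfl | hne
    · simp
    · have : 0 < (A ^ 3).card := hne.pow.card_pos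
      nlinarith

end ModularGrowth

theorem IsVirtuallyCyclic.isVirtuallyNilpotent {G : Type*} [Group G] (h : IsVirtuallyCyclic G) :
    Group.IsVirtuallyNilpotent G := by
  obtain ⟨N, hN, hfin⟩ := h
  let _ : CommGroup N := IsCyclic.commGroup
  exact ⟨N, CommGroup.isNilpotent, hfin⟩

theorem corollary3p5 :
    HasHelfgottTypeGrowth SL(2, ℤ) (1 / 31104) 1 ∧
      ∀ A : Finset SL(2, ℤ),
        ¬ IsVirtuallyCyclic (Subgroup.closure (A : Set SL(2, ℤ))) →
          (1 / 31104 : ℝ) * (A.card : ℝ) ^ 2 ≤ ((A ^ 3).card : ℝ) := by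
  have main : ∀ A : Finset SL(2, ℤ),
      ¬ IsVirtuallyCyclic (Subgroup.closure (A : Set SL(2, ℤ))) →
        (1 / 31104 : ℝ) * (A.card : ℝ) ^ 2 ≤ ((A ^ 3).card : ℝ) := by
    intro A hA
    have h : ((A.card ^ 2 : ℕ) : ℝ) ≤ ((31104 * (A ^ 3).card : ℕ) : ℝ) :=
      Nat.cast_le.2 (ModularGrowth.sq_card_le A hA)
    push_cast at h
    linarith
  refine ⟨⟨?_, by norm_num, one_pos, fun A hA => ?_⟩, main⟩
  · exact Infinite.of_injective _ ModularGrowth.mat_injective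
  · have h := main A fun hc => hA hc.isVirtuallyNilpotent
    rw [one_add_one_eq_two, Real.rpow_two]
    exact h
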